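/- **Theorem 1.1 (Strong Comparison Principle).** Let $\Omega\subset\mathbb{R}^n$ be a connected open set and let $X_1,\dots,X_m$ be smooth vector fields on $\Omega$ satisfying Hörmander's finite rank condition: for every $x\in\Omega$, the values at $x$ of the vector fields in the Lie algebra generated by $X_1,\dots,X_m$ span $\mathbb{R}^n$. Write $Xu=(X_1u,\dots,X_mu)$, and let $X_j^*$ be the adjoint of $X_j$ in $L^2$ with respect to Lebesgue measure. Let $p>1$, $\beta,\gamma>0$, $\kappa\ge 0$, and let $A=(A_1,\dots,A_m):\mathbb{R}^m\to\mathbb{R}^m$ be differentiable on $\mathbb{R}^m\setminus\{0\}$ with derivative locally Lipschitz there (for instance, smooth on $\mathbb{R}^m\setminus\{0\}$), such that for a.e. $\xi\in\mathbb{R}^m$ and every $\eta\in\mathbb{R}^m$ $$\sum_{i,j=1}^m \frac{\partial A_j}{\partial \xi_i}(\xi)\,\eta_i\eta_j\ \ge\ \beta(\kappa+|\xi|)^{p-2}|\eta|^2,\qquad \sum_{i,j=1}^m\Big|\frac{\partial A_j}{\partial \xi_i}(\xi)\Big|\ \le\ \gamma(\kappa+|\xi|)^{p-2}.$$ Let $f:\Omega\times\mathbb{R}\to\mathbb{R}$,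 and let $u_1\in C^1(\Omega)$ and $u_2\in C^2(\Omega)$ (in particular this holds if $u_1\in C^1(\overline\Omega)$ and $u_2\in C^2(\overline\Omega)$) be weak solutions in $\Omega$ of $$\sum_{j=1}^m X_j^*\big(A_j(Xu)\big)=f(x,u),$$ that is, for $u=u_1$ and for $u=u_2$ the function $x\mapsto f(x,u(x))$ is locally integrable in $\Omega$ and $$\int_\Omega\sum_{j=1}^m A_j(Xu)\,X_j\varphi\,dx=\int_\Omega f(x,u)\,\varphi\,dx\qquad\text{for all }\varphi\in C_c^1(\Omega).$$ Assume that 1. $\partial_u f\le 0$, in the sense that $u\mapsto f(x,u)$ is nonincreasing on $\mathbb{R}$ for every $x\in\Omega$; 2. there are $L,\varepsilon_0>0$ with $|f(x,u_2(x)+\varepsilon)-f(x,u_2(x))|\le L\varepsilon$ for all $\varepsilon\in[0,\varepsilon_0]$ and $x\in\Omega$; 3. there is $\delta>0$ with $|Xu_2|\ge\delta$ in $\Omega$. If $u_1\ge u_2$ in $\Omega$, then either $u_1=u_2$ everywhere in $\Omega$, or $u_1>u_2$ everywhere in $\Omega$. -/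

import Mathlib

open MeasureTheory Set
open scoped ContDiff

/-- The Lie algebra `Lie[X₁, …, X_m]` (over `ℝ`) generated by the vector fields `X j`:
the smallest family of vector fields that contains every `X j` and is closed under
linear combinations and Lie brackets. -/
inductive LieGenerated {n m : ℕ}
    (X : Fin m → EuclideanSpace ℝ (Fin n) → EuclideanSpace ℝ (Fin n)) :
    (EuclideanSpace ℝ (Fin n) → EuclideanSpace ℝ (Fin n)) → Prop
  | basic (j : Fin m) : LieGenerated X (X j)
  | zero : LieGenerated X (fun _ => 0)
  | add {V W : EuclideanSpace ℝ (Fin n) → EuclideanSpace ℝ (Fin n)} :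
      LieGenerated X V → LieGenerated X W → LieGenerated X (fun x => V x + W x)
  | smul (c : ℝ) {V : EuclideanSpace ℝ (Fin n) → EuclideanSpace ℝ (Fin n)} :
      LieGenerated X V → LieGenerated X (fun x => c • V x)
  | bracket {V W : EuclideanSpace ℝ (Fin n) → EuclideanSpace ℝ (Fin n)} :
      LieGenerated X V → LieGenerated X W → LieGenerated X (VectorField.lieBracket ℝ V W)

/-- Hörmander's finite rank condition on `Ω`: at each point of `Ω` the vectors `V x`,
`V ∈ Lie[X₁, …, X_m]`, have rank `n`. -/
def HormanderCondition {n m : ℕ}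
    (X : Fin m → EuclideanSpace ℝ (Fin n) → EuclideanSpace ℝ (Fin n))
    (Ω : Set (EuclideanSpace ℝ (Fin n))) : Prop :=
  ∀ x ∈ Ω, Module.finrank ℝ
    (Submodule.span ℝ {v : EuclideanSpace ℝ (Fin n) | ∃ V, LieGenerated X V ∧ V x = v}) = n

/-- The horizontal gradient `X u = (X₁ u, …, X_m u)`, where `X_j u (x) = du_x (X_j (x))`. -/
noncomputable def horizontalGradient {n m : ℕ}
    (X : Fin m → EuclideanSpace ℝ (Fin n) → EuclideanSpace ℝ (Fin n))
    (u : EuclideanSpace ℝ (Fin n) → ℝ) (x : EuclideanSpace ℝ (Fin n)) :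
    EuclideanSpace ℝ (Fin m) :=
  WithLp.toLp 2 (fun j => fderiv ℝ u x (X j x))

/-- The partial derivative `∂A_j / ∂ξ_i` at `ξ`. -/
noncomputable def partialA {m : ℕ} (A : EuclideanSpace ℝ (Fin m) → EuclideanSpace ℝ (Fin m))
    (i j : Fin m) (ξ : EuclideanSpace ℝ (Fin m)) : ℝ :=
  (fderiv ℝ A ξ (EuclideanSpace.single i 1)) j

/-- The ellipticity and `p`-growth conditions on `A`, with constants `β`, `γ`, `κ`. -/
def StructureConditions {m : ℕ} (A : EuclideanSpace ℝ (Fin m) → EuclideanSpace ℝ (Fin m))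
    (p β γ κ : ℝ) : Prop :=
  ∀ᵐ ξ ∂(volume : Measure (EuclideanSpace ℝ (Fin m))),
    (∀ η : EuclideanSpace ℝ (Fin m),
      β * (κ + ‖ξ‖) ^ (p - 2) * ‖η‖ ^ 2 ≤ ∑ i, ∑ j, partialA A i j ξ * η i * η j) ∧
    ∑ i, ∑ j, |partialA A i j ξ| ≤ γ * (κ + ‖ξ‖) ^ (p - 2)

/-- `u` is a weak solution in `Ω` of `∑ j, X_j^* (A_j (X u)) = f (x, u)`, the adjoints being
taken in `L²` of Lebesgue measure: `x ↦ f (x, u x)` is locally integrable in `Ω`, and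
`∫_Ω ∑ j, A_j (X u) X_j φ = ∫_Ω f (x, u) φ` for every `φ ∈ C_c^1(Ω)`. -/
def IsWeakSolution {n m : ℕ}
    (X : Fin m → EuclideanSpace ℝ (Fin n) → EuclideanSpace ℝ (Fin n))
    (A : EuclideanSpace ℝ (Fin m) → EuclideanSpace ℝ (Fin m))
    (f : EuclideanSpace ℝ (Fin n) → ℝ → ℝ)
    (Ω : Set (EuclideanSpace ℝ (Fin n))) (u : EuclideanSpace ℝ (Fin n) → ℝ) : Prop :=
  LocallyIntegrableOn (fun x => f x (u x)) Ω volume ∧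
  ∀ φ : EuclideanSpace ℝ (Fin n) → ℝ,
    ContDiff ℝ 1 φ → HasCompactSupport φ → tsupport φ ⊆ Ω →
      ∫ x in Ω, ∑ j, A (horizontalGradient X u x) j * horizontalGradient X φ x j =
        ∫ x in Ω, f x (u x) * φ x

open Filter Topology Metric Asymptotics

/-! Let `Z` be the contact set `{u₁ = u₂}`, which is relatively closed in `Ω`. The theorem follows
from two independent facts: every `X j` is tangent to `Z` (Hopf), and a relatively closed set
tangent to fields satisfying Hörmander's condition is empty or all of the connected set `Ω` (Bony).

Hopf's lemma, `IsWeakSolution.tangentTo_contactSet`. Suppose some `X j` is not orthogonal to a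
proximal normal of `Z` at `z`. Shrink the exterior ball so that it touches `Z` only at `z`, and let
`b` be a small multiple of `exp (-α |y - x₀|²) - exp (-α |z - x₀|²)`, with `x₀` its centre. The
gradients of `u₁` and `u₂` agree at `z` because `u₁ - u₂` has a minimum there. As `X u₂ z ≠ 0`, all
horizontal gradients that occur near `z` lie in a ball away from the origin on which `A` is C¹ and
uniformly elliptic. Non-orthogonality makes the `α²` term of the operator positive, so `u₂ + b` is a
strict subsolution near `z` for large `α` (`barrier_divergence_lower_bound`). Weak comparison
(`IsWeakSolution.le_of_strict_subsolution`) gives `b ≤ u₁ - u₂` near `z`, with equality at `z`.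
Hence the gradient of `b` vanishes at `z`, although its component along `X j` does not.

Bony's propagation, `eq_empty_or_eq_of_tangentTo`. Flows of tangent fields preserve `Z`, so the
commutator of two such flows traces a curve in `Z` whose second-order velocity is the Lie bracket;
an exterior ball then forces the bracket to be tangent as well. Thus the whole generated Lie algebra
is tangent to `Z`. Since it spans, `Z` has no nonzero proximal normal, and so `Z` is open. -/

/-- The vector field `V` is orthogonal to every proximal normal of `Z`: whenever `z ∈ Z` is a
nearest point of `Z` to `x`, the vectors `V z` and `x - z` are orthogonal. -/
def TangentTo {E : Type*} [NormedAddCommGroup E] [InnerProductSpace ℝ E]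
    (V : E → E) (Z : Set E) : Prop :=
  ∀ z ∈ Z, ∀ x, (∀ z' ∈ Z, dist z x ≤ dist z' x) → inner ℝ (V z) (x - z) = 0

/-! ### Sets invariant under flows, and Lie brackets of tangent fields. -/

section Bony

variable {E : Type*} [NormedAddCommGroup E] [InnerProductSpace ℝ E]

/-- Points of `Z` outside `closedBall z₀ ρ` are more than `ρ / 2` away from `x`, hence farther than
`z₀`. Minimising over the compact part of `Z` inside that ball is therefore enough, and `Z` need
only be locally closed. -/
lemma exists_nearest_point {E : Type*} [PseudoMetricSpace E] [ProperSpace E] {Z : Set E}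
    {z₀ x : E} {ρ : ℝ} (hz₀ : z₀ ∈ Z)
    (hZ : IsClosed (Z ∩ closedBall z₀ ρ)) (hx : dist x z₀ < ρ / 2) :
    ∃ z ∈ Z, dist z z₀ < ρ ∧ ∀ z' ∈ Z, dist z x ≤ dist z' x := by
  have hρ : 0 < ρ := by linarith [dist_nonneg (x := x) (y := z₀)]
  have hK : IsCompact (Z ∩ closedBall z₀ ρ) :=
    (isCompact_closedBall z₀ ρ).of_isClosed_subset hZ inter_subset_right
  have hz₀K : z₀ ∈ Z ∩ closedBall z₀ ρ := ⟨hz₀, mem_closedBall_self hρ.le⟩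
  obtain ⟨z, hz, hmin⟩ := hK.exists_isMinOn ⟨z₀, hz₀K⟩
    (f := fun z => dist z x) (by fun_prop)
  have h1 : dist z x ≤ dist z₀ x := hmin hz₀K
  rw [dist_comm z₀ x] at h1
  refine ⟨z, hz.1, ?_, fun z' hz' => ?_⟩
  · linarith [dist_triangle z x z₀]
  · by_cases h : z' ∈ closedBall z₀ ρ
    · exact hmin ⟨hz', h⟩
    · rw [mem_closedBall, not_le] at h
      linarith [dist_triangle z' x z₀]

lemma TangentTo.smul_fun {V : E → E} {Z : Set E} (h : TangentTo V Z) (χ : E → ℝ) :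
    TangentTo (fun x => χ x • V x) Z := fun z hz x hx => by
  rw [inner_smul_left, h z hz x hx, mul_zero]

lemma TangentTo.neg {V : E → E} {Z : Set E} (h : TangentTo V Z) :
    TangentTo (fun x => -V x) Z := fun z hz x hx => by
  rw [inner_neg_left, h z hz x hx, neg_zero]

lemma TangentTo.add {V W : E → E} {Z : Set E} (hV : TangentTo V Z) (hW : TangentTo W Z) :
    TangentTo (fun x => V x + W x) Z := fun z hz x hx => by
  rw [inner_add_left, hV z hz x hx, hW z hz x hx, add_zero]

/-- Integral curves of a Lipschitz field tangent to `Z` that start in `Z` stay in `Z`. -/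
lemma TangentTo.mem_of_integralCurve [ProperSpace E] {V : E → E} {Z : Set E} {z₀ : E} {ρ T : ℝ}
    {K : NNReal} (hV : TangentTo V Z) (hLip : LipschitzWith K V) (hz₀ : z₀ ∈ Z)
    (hZ : IsClosed (Z ∩ closedBall z₀ ρ)) {c : ℝ → E}
    (hc : ∀ t ∈ Icc 0 T, HasDerivAt c (V (c t)) t)
    (hball : ∀ t ∈ Icc 0 T, dist (c t) z₀ < ρ / 2) (hc0 : c 0 ∈ Z) :
    ∀ t ∈ Icc 0 T, c t ∈ Z := by
  have hne : Z.Nonempty := ⟨z₀, hz₀⟩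
  have near : ∀ t ∈ Icc 0 T, ∃ z ∈ Z, infDist (c t) Z = dist (c t) z ∧
      ∀ z' ∈ Z, dist z (c t) ≤ dist z' (c t) := by
    intro t ht
    obtain ⟨z, hz, -, hmin⟩ := exists_nearest_point hz₀ hZ (hball t ht)
    refine ⟨z, hz, le_antisymm (infDist_le_dist_of_mem hz) ?_, hmin⟩
    refine (le_infDist hne).2 fun z' hz' => ?_
    rw [dist_comm, dist_comm (c t) z']
    exact hmin z' hz'
  -- Grönwall for the squared distance to `Z`. It need not be differentiable, but at each time it is
  -- touched from above by the squared distance to a fixed nearest point `z`, which bounds its right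
  -- difference quotients.
  have hgr := le_gronwallBound_of_liminf_deriv_right_le (f := fun t => infDist (c t) Z ^ 2)
    (f' := fun t => 2 * K * infDist (c t) Z ^ 2) (δ := 0) (K := 2 * K) (ε := 0) (a := 0) (b := T)
    (fun t ht => (((continuous_infDist_pt Z).continuousAt.comp
      (hc t ht).continuousAt).pow 2).continuousWithinAt)
    (fun t ht r hr => ?_) (by simp [infDist_zero_of_mem hc0]) (fun t ht => by simp)
  · intro t ht
    have h0 := hgr t ht
    simp only [sub_zero, gronwallBound_ε0, zero_mul] at h0
    obtain ⟨z, hz, hd, -⟩ := near t ht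
    have : infDist (c t) Z = 0 := by
      have := sq_nonneg (infDist (c t) Z)
      exact pow_eq_zero_iff (two_ne_zero) |>.1 (le_antisymm h0 this)
    rw [this] at hd
    rw [dist_eq_zero.1 hd.symm]
    exact hz
  · obtain ⟨z, hz, hd, hmin⟩ := near t (Ico_subset_Icc_self ht)
    have hderiv : HasDerivAt (fun s => ‖c s - z‖ ^ 2) (2 * inner ℝ (c t - z) (V (c t))) t :=
      ((hc t (Ico_subset_Icc_self ht)).sub_const z).norm_sq
    have hle : 2 * inner ℝ (c t - z) (V (c t)) < r := by
      refine lt_of_le_of_lt ?_ hr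
      -- Tangency allows `V z` to be subtracted for free; the Lipschitz bound then gives the growth
      -- rate `2 K` times the squared distance.
      have h1 : inner ℝ (c t - z) (V (c t)) = inner ℝ (c t - z) (V (c t) - V z) := by
        rw [inner_sub_right, real_inner_comm (V z), hV z hz _ hmin, sub_zero]
      have h2 : inner ℝ (c t - z) (V (c t) - V z) ≤ ‖c t - z‖ * (K * ‖c t - z‖) :=
        (real_inner_le_norm _ _).trans (by gcongr; exact hLip.norm_sub_le _ _)
      rw [h1, hd, dist_eq_norm]
      nlinarith
    have hslope := (hasDerivAt_iff_tendsto_slope.1 hderiv).mono_left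
      (nhdsWithin_mono (s := Ioi t) t (fun s hs => (ne_of_gt hs : s ≠ t)))
    refine ((hslope.eventually_lt_const hle).and self_mem_nhdsWithin).frequently.mono ?_
    rintro s ⟨hs, hts : t < s⟩
    refine lt_of_le_of_lt ?_ hs
    rw [slope_def_field, div_eq_inv_mul]
    have h3 : infDist (c s) Z ≤ ‖c s - z‖ := by
      rw [← dist_eq_norm]; exact infDist_le_dist_of_mem hz
    have h4 : infDist (c s) Z ^ 2 ≤ ‖c s - z‖ ^ 2 := by gcongr; exact infDist_nonneg
    rw [hd, dist_eq_norm]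
    have : 0 < (s - t)⁻¹ := inv_pos.2 (sub_pos.2 hts)
    gcongr

/-- Second order expansion of a time-`t` move along a tangent field, from a base point that
itself moves along a curve in `Z` with a second order expansion. -/
lemma TangentTo.exists_step [ProperSpace E] {V : E → E} {Z : Set E} {z₀ : E}
    {ρ M : ℝ} {K : NNReal} (hV : TangentTo V Z) (hVC : ContDiff ℝ 1 V) (hLip : LipschitzWith K V)
    (hM : ∀ x, ‖V x‖ ≤ M) (hρ : 0 < ρ) (hz₀ : z₀ ∈ Z) (hZ : IsClosed (Z ∩ closedBall z₀ ρ))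
    {p : ℝ → E} {a b : E}
    (hp : (fun t : ℝ => p t - z₀ - t • a - t ^ 2 • b) =o[𝓝[>] 0] fun t => t ^ 2)
    (hpZ : ∀ᶠ t in 𝓝[>] 0, p t ∈ Z) :
    ∃ p' : ℝ → E, ((fun t : ℝ => p' t - z₀ - t • (a + V z₀) -
        t ^ 2 • (b + fderiv ℝ V z₀ a + (1 / 2 : ℝ) • fderiv ℝ V z₀ (V z₀)))
          =o[𝓝[>] 0] fun t => t ^ 2) ∧ ∀ᶠ t in 𝓝[>] 0, p' t ∈ Z := by
  obtain ⟨r, hr, ε, hε, H⟩ :=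
    hVC.contDiffAt (x := z₀).exists_forall_mem_closedBall_exists_eq_forall_mem_Ioo_hasDerivAt 0
  choose! α hα0 hα using H
  -- The base point is within `(‖a‖ + ‖b‖ + 1) t` of `z₀` and the flow moves at speed at most `M`,
  -- so the whole trajectory stays within `C t`.
  set C : ℝ := ‖a‖ + ‖b‖ + 1 + M with hC
  have hM0 : 0 ≤ M := (norm_nonneg _).trans (hM z₀)
  have hC0 : 0 < C := by positivity
  set D := fderiv ℝ V z₀ with hD
  have small : ∀ x > (0 : ℝ), ∀ᶠ t in 𝓝[>] (0 : ℝ), t < x := fun x hx =>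
    (eventually_lt_nhds hx).filter_mono nhdsWithin_le_nhds
  have hpos : ∀ᶠ t in 𝓝[>] (0 : ℝ), 0 < t := self_mem_nhdsWithin
  have base : ∀ᶠ t in 𝓝[>] (0 : ℝ), ‖p t - z₀ - t • a‖ ≤ (‖b‖ + 1) * t ^ 2 ∧
      ‖p t - z₀‖ ≤ (‖a‖ + ‖b‖ + 1) * t := by
    filter_upwards [hp.def one_pos, hpos, small 1 one_pos] with t h1 h2 h3
    rw [one_mul, Real.norm_of_nonneg (by positivity)] at h1
    have h4 : ‖p t - z₀ - t • a‖ ≤ (‖b‖ + 1) * t ^ 2 := by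
      have : p t - z₀ - t • a = (p t - z₀ - t • a - t ^ 2 • b) + t ^ 2 • b := by abel
      rw [this]
      refine (norm_add_le _ _).trans ?_
      rw [norm_smul, Real.norm_of_nonneg (by positivity)]
      linarith
    refine ⟨h4, ?_⟩
    have h5 : ‖p t - z₀‖ ≤ ‖p t - z₀ - t • a‖ + ‖t • a‖ := norm_le_norm_sub_add _ _
    rw [norm_smul, Real.norm_of_nonneg h2.le] at h5
    have h6 : t ^ 2 ≤ t := by nlinarith
    nlinarith [norm_nonneg b, mul_le_mul_of_nonneg_left h6 (by positivity : 0 ≤ ‖b‖ + 1)]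
  have curve : ∀ᶠ t in 𝓝[>] (0 : ℝ), α (p t) 0 = p t ∧
      (∀ s ∈ Icc 0 t, HasDerivAt (α (p t)) (V (α (p t) s)) s) ∧
      ∀ s ∈ Icc 0 t, ‖α (p t) s - z₀‖ ≤ C * t := by
    filter_upwards [base, hpos, small ε hε, small (r / C) (by positivity)] with t ⟨_, h1⟩ h2 h3 h4
    have hmem : p t ∈ closedBall z₀ r := by
      rw [mem_closedBall, dist_eq_norm]
      refine h1.trans ?_
      rw [lt_div_iff₀ hC0] at h4
      nlinarith
    have hder : ∀ s ∈ Icc 0 t, HasDerivAt (α (p t)) (V (α (p t) s)) s := fun s hs =>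
      hα _ hmem s ⟨by linarith [hs.1], by linarith [hs.2]⟩
    refine ⟨hα0 _ hmem, hder, fun s hs => ?_⟩
    have h5 := norm_image_sub_le_of_norm_deriv_le_segment'
      (fun x hx => (hder x hx).hasDerivWithinAt) (fun x _ => hM _) s hs
    rw [hα0 _ hmem] at h5
    have h6 : ‖α (p t) s - z₀‖ ≤ ‖α (p t) s - p t‖ + ‖p t - z₀‖ :=
      norm_sub_le_norm_sub_add_norm_sub _ _ _
    have h7 : M * (s - 0) ≤ M * t := by gcongr; linarith [hs.2]
    rw [hC]; nlinarith
  -- The new curve is the flow of `V` for time `t` started at `p t`; the base point and the flow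
  -- time vary together.
  refine ⟨fun t => α (p t) t, ?_, ?_⟩
  · rw [isLittleO_iff]
    intro η hη
    have hdiff : HasFDerivAt V D z₀ := (hVC.differentiable one_ne_zero z₀).hasFDerivAt
    have hlin := isLittleO_iff.1 (hasFDerivAt_iff_isLittleO.1 hdiff)
      (show 0 < η / (4 * C) by positivity)
    obtain ⟨d, hd, hlin⟩ := Metric.eventually_nhds_iff.1 hlin
    set Q := ‖D‖ * (K * C + ‖b‖ + 1) with hQ
    have hQ0 : 0 ≤ Q := by positivity
    filter_upwards [base, curve, hpos, small (d / C) (by positivity),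
      small (η / (4 * (Q + 1))) (by positivity), hp.def (half_pos hη)]
       with t ⟨h1, _⟩ ⟨h0, hder, hnear⟩ ht hdt hQt hR
    rw [lt_div_iff₀ hC0] at hdt
    rw [lt_div_iff₀ (by positivity)] at hQt
    have first : ∀ s ∈ Icc 0 t, ‖α (p t) s - p t - s • V z₀‖ ≤ K * C * t ^ 2 := by
      intro s hs
      have h5 := norm_image_sub_le_of_norm_deriv_le_segment' (C := K * (C * t))
        (f := fun s => α (p t) s - s • V z₀) (f' := fun s => V (α (p t) s) - (1 : ℝ) • V z₀)
        (fun x hx => ((hder x hx).sub ((hasDerivAt_id x).smul_const (V z₀))).hasDerivWithinAt)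
        (fun x hx => by
          rw [one_smul]
          exact (hLip.norm_sub_le _ _).trans
            (by gcongr; exact hnear x (Ico_subset_Icc_self hx))) s hs
      simp only [h0, zero_smul, sub_zero] at h5
      have e1 : α (p t) s - p t - s • V z₀ = α (p t) s - s • V z₀ - p t := by abel
      rw [e1]
      refine h5.trans ?_
      have : K * (C * t) * s ≤ K * (C * t) * t := by gcongr; exact hs.2
      linarith
    -- For fixed `t`, the mean value inequality in the flow time `s`, after subtracting the expected
    -- second-order polynomial. The derivative is the Taylor remainder of `V` at `z₀` plus `D`
    -- applied to the first-order errors of trajectory and base point, that is `o(t) + O(t²)`.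
    have second := norm_image_sub_le_of_norm_deriv_le_segment' (C := η / 2 * t)
      (f := fun s => α (p t) s - s • V z₀ - s • (t • D a) - (s ^ 2 / 2) • D (V z₀))
      (f' := fun s => V (α (p t) s) - (1 : ℝ) • V z₀ - (1 : ℝ) • (t • D a) - s • D (V z₀))
      (fun x hx => by
        have e : HasDerivAt (fun s : ℝ => s ^ 2 / 2) x x := by
          simpa using ((hasDerivAt_id x).pow 2).div_const 2
        exact ((((hder x hx).sub ((hasDerivAt_id x).smul_const (V z₀))).sub
          ((hasDerivAt_id x).smul_const _)).sub (e.smul_const _)).hasDerivWithinAt)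
      (fun s hs => by
        have hs' := Ico_subset_Icc_self hs
        have e2 : V (α (p t) s) - (1 : ℝ) • V z₀ - (1 : ℝ) • (t • D a) - s • D (V z₀) =
            (V (α (p t) s) - V z₀ - D (α (p t) s - z₀)) +
              D ((α (p t) s - p t - s • V z₀) + (p t - z₀ - t • a)) := by
          simp only [map_add, map_sub, map_smul, one_smul]; abel
        rw [e2]
        have h6 : ‖V (α (p t) s) - V z₀ - D (α (p t) s - z₀)‖ ≤ η / (4 * C) * (C * t) := by
          refine (hlin (y := α (p t) s) ?_).trans ?_
          · rw [dist_eq_norm]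
            exact (hnear s hs').trans_lt (by linarith)
          · gcongr
            exact hnear s hs'
        have h7 : ‖D ((α (p t) s - p t - s • V z₀) + (p t - z₀ - t • a))‖ ≤ Q * t ^ 2 := by
          refine (D.le_opNorm _).trans ?_
          rw [hQ, mul_assoc]
          gcongr
          refine (norm_add_le _ _).trans ?_
          linarith [first s hs']
        have h8 : η / (4 * C) * (C * t) = η / 4 * t := by field_simp
        rw [h8] at h6
        refine (norm_add_le _ _).trans ((add_le_add h6 h7).trans ?_)
        have : Q * t ≤ η / 4 := by nlinarith
        nlinarith) t ⟨ht.le, le_rfl⟩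
    simp only [h0, zero_smul, sub_zero, ne_eq, OfNat.ofNat_ne_zero, not_false_eq_true, zero_pow,
      zero_div] at second
    rw [Real.norm_of_nonneg (by positivity)] at hR ⊢
    have e3 : α (p t) t - z₀ - t • (a + V z₀) - t ^ 2 • (b + D a + (1 / 2 : ℝ) • D (V z₀)) =
        (p t - z₀ - t • a - t ^ 2 • b) +
        (α (p t) t - t • V z₀ - t • (t • D a) - (t ^ 2 / 2) • D (V z₀) - p t) := by
      module
    rw [e3]
    refine (norm_add_le _ _).trans ?_
    nlinarith
  · filter_upwards [curve, hpos, hpZ, small (ρ / 2 / C) (by positivity)]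
      with t ⟨h0, hder, hnear⟩ ht hptZ hρt
    rw [lt_div_iff₀ hC0] at hρt
    refine hV.mem_of_integralCurve hLip hz₀ hZ hder (fun s hs => ?_) (by rwa [h0]) t
      ⟨ht.le, le_rfl⟩
    rw [dist_eq_norm]
    exact (hnear s hs).trans_lt (by linarith)

/-- Multiplication by a scalar function preserves tangency, so a bump function makes the field
globally Lipschitz and bounded without changing its germ at `z₀`, hence without changing brackets
there. -/
lemma TangentTo.exists_cutoff [FiniteDimensional ℝ E] {V : E → E} {Z Ω : Set E} {z₀ : E}
    (hV : TangentTo V Z) (hΩ : IsOpen Ω) (hVC : ContDiffOn ℝ 1 V Ω) (hz₀ : z₀ ∈ Ω) :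
    ∃ V' : E → E, V' =ᶠ[𝓝 z₀] V ∧ TangentTo V' Z ∧ ContDiff ℝ 1 V' ∧
      (∃ K, LipschitzWith K V') ∧ ∃ M, ∀ x, ‖V' x‖ ≤ M := by
  obtain ⟨R, hR, hRΩ⟩ := nhds_basis_closedBall.mem_iff.1 (hΩ.mem_nhds hz₀)
  let χ : ContDiffBump z₀ := ⟨R / 2, R, by positivity, by linarith⟩
  have hC : ContDiff ℝ 1 (fun x => χ x • V x) := by
    rw [contDiff_iff_contDiffAt]
    intro x
    by_cases hx : x ∈ Ω
    · exact χ.contDiff.contDiffAt.smul (hVC.contDiffAt (hΩ.mem_nhds hx))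
    · have hx' : x ∉ tsupport χ := by
        rw [χ.tsupport_eq]; exact fun h => hx (hRΩ h)
      refine contDiffAt_const (c := (0 : E)) |>.congr_of_eventuallyEq ?_
      filter_upwards [notMem_tsupport_iff_eventuallyEq.1 hx'] with y hy
      simp [hy]
  have hcs : HasCompactSupport (fun x => χ x • V x) := χ.hasCompactSupport.smul_right
  refine ⟨fun x => χ x • V x, ?_, hV.smul_fun χ, hC,
    ⟨_, hC.lipschitzWith_of_hasCompactSupport hcs one_ne_zero |>.choose_spec⟩, ?_⟩
  · filter_upwards [χ.eventuallyEq_one] with x hx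
    simp [hx]
  · exact hcs.exists_bound_of_continuous hC.continuous

/-- A curve in `Z` with expansion `z + t² b + o(t²)` cannot enter an exterior ball at `z`. -/
lemma inner_nonpos_of_expansion {Z : Set E} {z x b : E} {p : ℝ → E}
    (hx : ∀ z' ∈ Z, dist z x ≤ dist z' x)
    (hp : (fun t : ℝ => p t - z - t ^ 2 • b) =o[𝓝[>] 0] fun t => t ^ 2)
    (hpZ : ∀ᶠ t in 𝓝[>] 0, p t ∈ Z) : inner ℝ b (x - z) ≤ 0 := by
  have hpos : ∀ᶠ t in 𝓝[>] (0 : ℝ), 0 < t := self_mem_nhdsWithin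
  -- `q t` tends to `b`. Expanding `‖x - z‖² ≤ ‖x - z - t² q‖²` gives `⟨q, x - z⟩ ≤ t² ‖q‖² / 2`,
  -- whose right side tends to zero.
  set q : ℝ → E := fun t => (t ^ 2)⁻¹ • (p t - z) with hq
  have hqlim : Tendsto q (𝓝[>] 0) (𝓝 b) := by
    have h1 : Tendsto (fun t : ℝ => (t ^ 2)⁻¹ • (p t - z - t ^ 2 • b)) (𝓝[>] 0) (𝓝 0) := by
      rw [tendsto_zero_iff_norm_tendsto_zero]
      refine hp.norm_norm.tendsto_div_nhds_zero.congr fun t => ?_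
      rw [norm_smul, norm_inv, div_eq_inv_mul]
    have h2 := h1.add_const b
    rw [zero_add] at h2
    refine h2.congr' ?_
    filter_upwards [hpos] with t ht
    have : (t ^ 2)⁻¹ * t ^ 2 = 1 := inv_mul_cancel₀ (by positivity)
    rw [smul_sub, smul_smul, this, one_smul, sub_add_cancel]
  have ht0 : Tendsto (fun t : ℝ => t) (𝓝[>] 0) (𝓝 0) := tendsto_id.mono_left nhdsWithin_le_nhds
  have hl : Tendsto (fun t => inner ℝ (q t) (x - z)) (𝓝[>] 0) (𝓝 (inner ℝ b (x - z))) :=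
    hqlim.inner tendsto_const_nhds
  have hr : Tendsto (fun t => t ^ 2 * ‖q t‖ ^ 2 / 2) (𝓝[>] 0) (𝓝 0) := by
    simpa using (((ht0.pow 2).mul (hqlim.norm.pow 2)).div_const 2)
  refine le_of_tendsto_of_tendsto hl hr ?_
  filter_upwards [hpos, hpZ] with t ht hpt
  have h1 := hx _ hpt
  rw [dist_comm z, dist_comm (p t), dist_eq_norm, dist_eq_norm] at h1
  have h2 : x - p t = (x - z) - t ^ 2 • q t := by
    have : t ^ 2 * (t ^ 2)⁻¹ = 1 := mul_inv_cancel₀ (by positivity)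
    simp only [hq, smul_smul, this, one_smul]; abel
  have h3 : ‖x - z‖ ^ 2 ≤ ‖x - p t‖ ^ 2 := by gcongr
  rw [h2, norm_sub_sq_real (x - z), inner_smul_right, norm_smul, Real.norm_of_nonneg (by positivity),
    real_inner_comm] at h3
  have h4 : t ^ 2 * inner ℝ (q t) (x - z) ≤ t ^ 2 * (t ^ 2 * ‖q t‖ ^ 2 / 2) := by nlinarith
  exact le_of_mul_le_mul_left h4 (by positivity)

/-- Flow along `V`, `W`, `-V`, `-W` in turn, each for time `t`. The first-order coefficients run
through `V`, `V + W`, `W`, `0`, and the second-order terms add up to `DW V - DV W`, the bracket. The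
resulting curve lies in `Z`. -/
lemma TangentTo.inner_lieBracket_nonpos [FiniteDimensional ℝ E] {V W : E → E} {Z Ω : Set E}
    (hΩ : IsOpen Ω) (hZΩ : Z ⊆ Ω) (hZ : ∀ z ∈ Z, ∃ ρ > 0, IsClosed (Z ∩ closedBall z ρ))
    (hV : TangentTo V Z) (hW : TangentTo W Z) (hVC : ContDiffOn ℝ 1 V Ω)
    (hWC : ContDiffOn ℝ 1 W Ω) {z x : E} (hz : z ∈ Z) (hx : ∀ z' ∈ Z, dist z x ≤ dist z' x) :
    inner ℝ (VectorField.lieBracket ℝ V W z) (x - z) ≤ 0 := by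
  have : ProperSpace E := FiniteDimensional.proper ℝ E
  obtain ⟨ρ, hρ, hcl⟩ := hZ z hz
  obtain ⟨V', hVV', hV', hVC', ⟨K, hK⟩, M, hM⟩ := hV.exists_cutoff hΩ hVC (hZΩ hz)
  obtain ⟨W', hWW', hW', hWC', ⟨N, hN⟩, B, hB⟩ := hW.exists_cutoff hΩ hWC (hZΩ hz)
  rw [← hVV'.lieBracket_vectorField_eq hWW']
  obtain ⟨p₁, hp₁, hp₁Z⟩ := hV'.exists_step hVC' hK hM hρ hz hcl (p := fun _ => z) (a := 0)
    (b := 0) (by simp) (by simp [hz])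
  obtain ⟨p₂, hp₂, hp₂Z⟩ := hW'.exists_step hWC' hN hB hρ hz hcl hp₁ hp₁Z
  obtain ⟨p₃, hp₃, hp₃Z⟩ := hV'.neg.exists_step hVC'.neg hK.neg (by simpa using hM) hρ hz hcl
    hp₂ hp₂Z
  obtain ⟨p₄, hp₄, hp₄Z⟩ := hW'.neg.exists_step hWC'.neg hN.neg (by simpa using hB) hρ hz hcl
    hp₃ hp₃Z
  refine inner_nonpos_of_expansion hx (p := p₄) ?_ hp₄Z
  refine hp₄.congr_left fun t => ?_
  have e1 : fderiv ℝ (fun x => -V' x) z = -fderiv ℝ V' z := fderiv_fun_neg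
  have e2 : fderiv ℝ (fun x => -W' x) z = -fderiv ℝ W' z := fderiv_fun_neg
  rw [e1, e2, VectorField.lieBracket]
  simp only [map_add, map_neg, map_zero, neg_apply]
  module

/-- Fields tangent to a locally closed set are stable under Lie brackets. -/
lemma TangentTo.lieBracket [FiniteDimensional ℝ E] {V W : E → E} {Z Ω : Set E}
    (hΩ : IsOpen Ω) (hZΩ : Z ⊆ Ω) (hZ : ∀ z ∈ Z, ∃ ρ > 0, IsClosed (Z ∩ closedBall z ρ))
    (hV : TangentTo V Z) (hW : TangentTo W Z) (hVC : ContDiffOn ℝ 1 V Ω)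
    (hWC : ContDiffOn ℝ 1 W Ω) : TangentTo (VectorField.lieBracket ℝ V W) Z := by
  intro z hz x hx
  refine le_antisymm (inner_lieBracket_nonpos hΩ hZΩ hZ hV hW hVC hWC hz hx) ?_
  have h := inner_lieBracket_nonpos hΩ hZΩ hZ hW hV hWC hVC hz hx
  rw [VectorField.lieBracket_swap, inner_neg_left] at h
  linarith

end Bony

/-! ### Propagation under Hörmander's condition. -/

/-- Smoothness is carried through the induction because each bracket step needs C¹ fields and loses
a derivative. -/
lemma LieGenerated.contDiffOn_and_tangentTo {n m : ℕ}
    {X : Fin m → EuclideanSpace ℝ (Fin n) → EuclideanSpace ℝ (Fin n)}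
    {Ω Z : Set (EuclideanSpace ℝ (Fin n))} (hΩ : IsOpen Ω) (hZΩ : Z ⊆ Ω)
    (hZ : ∀ z ∈ Z, ∃ ρ > 0, IsClosed (Z ∩ closedBall z ρ))
    (hX : ∀ j, ContDiffOn ℝ ∞ (X j) Ω) (hT : ∀ j, TangentTo (X j) Z)
    {V : EuclideanSpace ℝ (Fin n) → EuclideanSpace ℝ (Fin n)} (hV : LieGenerated X V) :
    ContDiffOn ℝ ∞ V Ω ∧ TangentTo V Z := by
  have h1 : (1 : WithTop ℕ∞) ≤ ∞ := by exact_mod_cast le_top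
  induction hV with
  | basic j => exact ⟨hX j, hT j⟩
  | zero => exact ⟨contDiffOn_const, fun z _ x _ => inner_zero_left _⟩
  | add _ _ hV hW => exact ⟨hV.1.add hW.1, hV.2.add hW.2⟩
  | smul c _ hV => exact ⟨hV.1.const_smul c, hV.2.smul_fun _⟩
  | bracket _ _ hV hW =>
    refine ⟨fun x hx => ?_, hV.2.lieBracket hΩ hZΩ hZ hW.2 (hV.1.of_le h1) (hW.1.of_le h1)⟩
    exact ((hV.1.contDiffAt (hΩ.mem_nhds hx)).lieBracket_vectorField
      (hW.1.contDiffAt (hΩ.mem_nhds hx)) (by simp)).contDiffWithinAt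

/-- **Bony's propagation**: a relatively closed subset of a connected open set whose proximal
normals are orthogonal to fields satisfying Hörmander's condition is empty or everything. -/
lemma eq_empty_or_eq_of_tangentTo {n m : ℕ}
    {X : Fin m → EuclideanSpace ℝ (Fin n) → EuclideanSpace ℝ (Fin n)}
    {Ω Z : Set (EuclideanSpace ℝ (Fin n))} (hΩ : IsOpen Ω) (hΩc : IsPreconnected Ω) (hZΩ : Z ⊆ Ω)
    (hZc : IsOpen (Ω \ Z)) (hX : ∀ j, ContDiffOn ℝ ∞ (X j) Ω) (hH : HormanderCondition X Ω)
    (hT : ∀ j, TangentTo (X j) Z) : Z = ∅ ∨ Z = Ω := by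
  have hcl : ∀ z ∈ Z, ∃ ρ > 0, closedBall z ρ ⊆ Ω ∧ IsClosed (Z ∩ closedBall z ρ) := by
    intro z hz
    obtain ⟨ρ, hρ, hρΩ⟩ := nhds_basis_closedBall.mem_iff.1 (hΩ.mem_nhds (hZΩ hz))
    refine ⟨ρ, hρ, hρΩ, ?_⟩
    have : Z ∩ closedBall z ρ = closedBall z ρ ∩ (Ω \ Z)ᶜ := by
      ext x
      simp only [mem_inter_iff, mem_compl_iff, Set.mem_sdiff, not_and, not_not]
      exact ⟨fun h => ⟨h.2, fun _ => h.1⟩, fun h => ⟨h.2 (hρΩ h.1), h.1⟩⟩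
    rw [this]
    exact isClosed_closedBall.inter hZc.isClosed_compl
  -- A proximal normal is orthogonal to the span of the Lie algebra, which is everything, so it is
  -- zero. Every point close to `Z` then equals its own nearest point, which makes `Z` open.
  have hnormal : ∀ z ∈ Z, ∀ x, (∀ z' ∈ Z, dist z x ≤ dist z' x) → x = z := by
    intro z hz x hx
    have hspan : Submodule.span ℝ {v | ∃ V, LieGenerated X V ∧ V z = v} = ⊤ :=
      Submodule.eq_top_of_finrank_eq (by rw [hH z (hZΩ hz), finrank_euclideanSpace_fin])
    have hle : Submodule.span ℝ {v | ∃ V, LieGenerated X V ∧ V z = v} ≤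
        (innerSL ℝ (x - z)).toLinearMap.ker := by
      rw [Submodule.span_le]
      rintro v ⟨V, hV, rfl⟩
      have h := (hV.contDiffOn_and_tangentTo hΩ hZΩ
        (fun z hz => (hcl z hz).imp fun ρ h => ⟨h.1, h.2.2⟩) hX hT).2 z hz x hx
      simpa only [SetLike.mem_coe, LinearMap.mem_ker, ContinuousLinearMap.coe_coe,
        innerSL_apply_apply, real_inner_comm] using h
    rw [hspan] at hle
    have h0 : inner ℝ (x - z) (x - z) = 0 := hle (Submodule.mem_top (x := x - z))
    exact sub_eq_zero.1 (inner_self_eq_zero.1 h0)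
  have hZo : IsOpen Z := by
    rw [Metric.isOpen_iff]
    intro z hz
    obtain ⟨ρ, hρ, -, hc⟩ := hcl z hz
    refine ⟨ρ / 2, by positivity, fun x hx => ?_⟩
    obtain ⟨y, hy, -, hmin⟩ := exists_nearest_point hz hc hx
    rwa [hnormal y hy x hmin]
  by_contra! h
  obtain ⟨z, hz⟩ := h.1
  obtain ⟨x, hxΩ, hxZ⟩ : ∃ x ∈ Ω, x ∉ Z := by
    by_contra! h'
    exact h.2 (subset_antisymm hZΩ h')
  obtain ⟨y, -, hy1, hy2⟩ := hΩc Z (Ω \ Z) hZo hZc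
    (fun y hy => by by_cases h : y ∈ Z <;> simp [h, hy]) ⟨z, hZΩ hz, hz⟩ ⟨x, hxΩ, hxΩ, hxZ⟩
  exact hy2.2 hy1

/-! ### Integration by parts along vector fields. -/

section Divergence

variable {n m : ℕ}

/-- The divergence of a vector field on `ℝⁿ`. -/
noncomputable def divergence (X : EuclideanSpace ℝ (Fin n) → EuclideanSpace ℝ (Fin n))
    (x : EuclideanSpace ℝ (Fin n)) : ℝ :=
  ∑ i, (fderiv ℝ X x (EuclideanSpace.single i 1)) i

lemma integrable_of_continuousOn_of_support_subset {F : EuclideanSpace ℝ (Fin n) → ℝ}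
    {C : Set (EuclideanSpace ℝ (Fin n))} (hC : IsCompact C) (hF : ContinuousOn F C)
    (hs : Function.support F ⊆ C) : Integrable F :=
  (integrableOn_iff_integrable_of_support_subset hs).1 (hF.integrableOn_compact hC)

lemma ContDiffOn.continuousOn_divergence
    {X : EuclideanSpace ℝ (Fin n) → EuclideanSpace ℝ (Fin n)}
    {U : Set (EuclideanSpace ℝ (Fin n))} (hU : IsOpen U) (hX : ContDiffOn ℝ 1 X U) :
    ContinuousOn (divergence X) U := by
  have h := hX.continuousOn_fderiv_of_isOpen hU le_rfl
  unfold divergence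
  refine continuousOn_finsetSum _ fun i _ => ?_
  exact (EuclideanSpace.proj i).continuous.comp_continuousOn (h.clm_apply continuousOn_const)

lemma integral_fderiv_single_eq_zero {g : EuclideanSpace ℝ (Fin n) → ℝ} (hg : ContDiff ℝ 1 g)
    (hgc : HasCompactSupport g) (v : EuclideanSpace ℝ (Fin n)) : ∫ x, fderiv ℝ g x v = 0 := by
  have hint : Integrable fun x => fderiv ℝ g x v :=
    ((hg.continuous_fderiv one_ne_zero).clm_apply continuous_const).integrable_of_hasCompactSupport
      (hgc.fderiv_apply ℝ v)
  have h := integral_mul_fderiv_eq_neg_fderiv_mul_of_integrable (μ := volume) (𝕜 := ℝ)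
    (f := fun _ => (1 : ℝ)) (g := g) (v := v) (by simp) (by simpa using hint)
    (by simpa using hg.continuous.integrable_of_hasCompactSupport hgc)
    (fun x _ => differentiableAt_const _) (fun x _ => hg.differentiable one_ne_zero x)
  simpa using h

lemma ContDiffOn.contDiff_mul_of_tsupport_subset {φ ψ : EuclideanSpace ℝ (Fin n) → ℝ}
    {U : Set (EuclideanSpace ℝ (Fin n))} (hU : IsOpen U) (hψ : ContDiffOn ℝ 1 ψ U)
    (hφ : ContDiff ℝ 1 φ) (hφU : tsupport φ ⊆ U) : ContDiff ℝ 1 (fun x => φ x * ψ x) := by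
  rw [contDiff_iff_contDiffAt]
  intro x
  by_cases hx : x ∈ tsupport φ
  · exact hφ.contDiffAt.mul (hψ.contDiffAt (hU.mem_nhds (hφU hx)))
  · refine (contDiffAt_const (c := (0 : ℝ))).congr_of_eventuallyEq ?_
    filter_upwards [notMem_tsupport_iff_eventuallyEq.1 hx] with y hy
    simp [hy]

lemma clm_apply_eq_sum {F : Type*} [NormedAddCommGroup F] [NormedSpace ℝ F]
    (T : EuclideanSpace ℝ (Fin n) →L[ℝ] F) (v : EuclideanSpace ℝ (Fin n)) :
    T v = ∑ i, v i • T (EuclideanSpace.single i 1) := by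
  have h : v = ∑ i, v i • EuclideanSpace.single i (1 : ℝ) := by
    have := (EuclideanSpace.basisFun (Fin n) ℝ).sum_repr v
    simpa using this.symm
  conv_lhs => rw [h]
  simp

/-- The divergence theorem for `θ X` with `θ` compactly supported. -/
lemma integral_fderiv_apply_eq_neg_integral_mul_divergence {θ : EuclideanSpace ℝ (Fin n) → ℝ}
    {X : EuclideanSpace ℝ (Fin n) → EuclideanSpace ℝ (Fin n)}
    {U : Set (EuclideanSpace ℝ (Fin n))} (hU : IsOpen U) (hX : ContDiffOn ℝ 1 X U)
    (hθ : ContDiff ℝ 1 θ) (hθc : HasCompactSupport θ) (hθU : tsupport θ ⊆ U) :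
    ∫ x, fderiv ℝ θ x (X x) = -∫ x, θ x * divergence X x := by
  have hXi : ∀ i, ContDiffOn ℝ 1 (fun x => X x i) U := fun i =>
    (EuclideanSpace.proj (𝕜 := ℝ) i).contDiff.comp_contDiffOn hX
  have hg : ∀ i, ContDiff ℝ 1 (fun x => θ x * X x i) := fun i =>
    (hXi i).contDiff_mul_of_tsupport_subset hU hθ hθU
  have hgc : ∀ i, HasCompactSupport (fun x => θ x * X x i) := fun i => hθc.mul_right
  have hpt : ∀ x, ∑ i, fderiv ℝ (fun x => θ x * X x i) x (EuclideanSpace.single i 1) =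
      fderiv ℝ θ x (X x) + θ x * divergence X x := by
    intro x
    by_cases hx : x ∈ tsupport θ
    · have hXx := (hX.contDiffAt (hU.mem_nhds (hθU hx))).differentiableAt one_ne_zero
      have hd : ∀ i, fderiv ℝ (fun x => θ x * X x i) x (EuclideanSpace.single i 1) =
          X x i * fderiv ℝ θ x (EuclideanSpace.single i 1) +
            θ x * (fderiv ℝ X x (EuclideanSpace.single i 1)) i := by
        intro i
        have h1 : HasFDerivAt (fun x => X x i)
            ((EuclideanSpace.proj (𝕜 := ℝ) i).comp (fderiv ℝ X x)) x :=
          (EuclideanSpace.proj (𝕜 := ℝ) i).hasFDerivAt.comp x hXx.hasFDerivAt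
        have h2 := ((hθ.differentiable one_ne_zero x).hasFDerivAt.mul h1).fderiv
        rw [show (fun x => θ x * X x i) = θ * fun x => X x i from rfl, h2]
        simp [add_comm]
      rw [Finset.sum_congr rfl fun i _ => hd i, Finset.sum_add_distrib, divergence,
        Finset.mul_sum, clm_apply_eq_sum (fderiv ℝ θ x) (X x)]
      simp
    · have h0 := notMem_tsupport_iff_eventuallyEq.1 hx
      have h1 : ∀ i, fderiv ℝ (fun x => θ x * X x i) x = 0 := by
        intro i
        have : (fun x => θ x * X x i) =ᶠ[𝓝 x] fun _ => 0 := by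
          filter_upwards [h0] with y hy
          simp [hy]
        rw [this.fderiv_eq]; simp
      simp [h1, fderiv_of_notMem_tsupport ℝ hx, image_eq_zero_of_notMem_tsupport hx]
  have hsum : ∫ x, ∑ i, fderiv ℝ (fun x => θ x * X x i) x (EuclideanSpace.single i 1) = 0 := by
    rw [integral_finsetSum]
    · exact Finset.sum_eq_zero fun i _ => integral_fderiv_single_eq_zero (hg i) (hgc i) _
    · exact fun i _ => (((hg i).continuous_fderiv one_ne_zero).clm_apply
        continuous_const).integrable_of_hasCompactSupport ((hgc i).fderiv_apply ℝ _)
  have hi1 : Integrable fun x => fderiv ℝ θ x (X x) := by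
    refine integrable_of_continuousOn_of_support_subset hθc
      (((hθ.continuous_fderiv one_ne_zero).continuousOn).clm_apply (hX.continuousOn.mono hθU)) ?_
    intro x hx
    by_contra h
    exact hx (by simp [fderiv_of_notMem_tsupport ℝ h])
  have hi2 : Integrable fun x => θ x * divergence X x := by
    refine integrable_of_continuousOn_of_support_subset hθc
      (hθ.continuous.continuousOn.mul ((hX.continuousOn_divergence hU).mono hθU)) ?_
    intro x hx
    by_contra h
    exact hx (by simp [image_eq_zero_of_notMem_tsupport h])
  simp_rw [hpt] at hsum
  rw [integral_add hi1 hi2] at hsum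
  linarith

lemma divergence_sum_smul {X : Fin m → EuclideanSpace ℝ (Fin n) → EuclideanSpace ℝ (Fin n)}
    {V : EuclideanSpace ℝ (Fin n) → EuclideanSpace ℝ (Fin m)} {x : EuclideanSpace ℝ (Fin n)}
    (hX : ∀ j, DifferentiableAt ℝ (X j) x) (hV : DifferentiableAt ℝ V x) :
    divergence (fun x => ∑ j, V x j • X j x) x =
      ∑ j, ((fderiv ℝ V x (X j x)) j + V x j * divergence (X j) x) := by
  have h1 : ∀ j, HasFDerivAt (fun x => V x j)
      ((EuclideanSpace.proj (𝕜 := ℝ) j).comp (fderiv ℝ V x)) x := fun j =>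
    (EuclideanSpace.proj (𝕜 := ℝ) j).hasFDerivAt.comp x hV.hasFDerivAt
  have h2 := (HasFDerivAt.fun_sum (u := Finset.univ)
    fun j _ => (h1 j).smul (hX j).hasFDerivAt).fderiv
  have h3 : ∀ j, (fderiv ℝ V x (X j x)) j =
      ∑ i, X j x i * (fderiv ℝ V x (EuclideanSpace.single i 1)) j := by
    intro j
    rw [clm_apply_eq_sum (fderiv ℝ V x) (X j x)]
    simp
  simp only [divergence, Finset.mul_sum, h3, ← Finset.sum_add_distrib]
  rw [Finset.sum_comm]
  refine Finset.sum_congr rfl fun i _ => ?_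
  erw [h2]
  simp [add_comm, mul_comm]

lemma sum_mul_horizontalGradient
    (X : Fin m → EuclideanSpace ℝ (Fin n) → EuclideanSpace ℝ (Fin n))
    (V : EuclideanSpace ℝ (Fin n) → EuclideanSpace ℝ (Fin m))
    (φ : EuclideanSpace ℝ (Fin n) → ℝ) (x : EuclideanSpace ℝ (Fin n)) :
    ∑ j, V x j * horizontalGradient X φ x j = fderiv ℝ φ x (∑ j, V x j • X j x) := by
  simp [horizontalGradient]

/-- The divergence theorem for `φ ∑ j, V_j X_j`. The sum multiplying `φ` is `-∑ j, X_j^* V_j`, so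
this passes between the weak and pointwise forms of the operator when the flux `V` is C¹. -/
lemma integral_sum_mul_horizontalGradient
    {X : Fin m → EuclideanSpace ℝ (Fin n) → EuclideanSpace ℝ (Fin n)}
    {V : EuclideanSpace ℝ (Fin n) → EuclideanSpace ℝ (Fin m)} {φ : EuclideanSpace ℝ (Fin n) → ℝ}
    {U : Set (EuclideanSpace ℝ (Fin n))} (hU : IsOpen U) (hX : ∀ j, ContDiffOn ℝ 1 (X j) U)
    (hV : ContDiffOn ℝ 1 V U)
    (hφ : ContDiff ℝ 1 φ) (hφc : HasCompactSupport φ) (hφU : tsupport φ ⊆ U) :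
    Integrable (fun x => φ x * ∑ j, ((fderiv ℝ V x (X j x)) j + V x j * divergence (X j) x)) ∧
    ∫ x, ∑ j, V x j * horizontalGradient X φ x j =
      -∫ x, φ x * ∑ j, ((fderiv ℝ V x (X j x)) j + V x j * divergence (X j) x) := by
  have hY : ContDiffOn ℝ 1 (fun x => ∑ j, V x j • X j x) U :=
    ContDiffOn.sum fun j _ => ((EuclideanSpace.proj (𝕜 := ℝ) j).contDiff.comp_contDiffOn hV).smul
      (hX j)
  have hD : ∀ x, φ x * ∑ j, ((fderiv ℝ V x (X j x)) j + V x j * divergence (X j) x) =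
      φ x * divergence (fun x => ∑ j, V x j • X j x) x := by
    intro x
    by_cases hx : x ∈ U
    · rw [divergence_sum_smul
        (fun j => ((hX j).contDiffAt (hU.mem_nhds hx)).differentiableAt one_ne_zero)
        ((hV.contDiffAt (hU.mem_nhds hx)).differentiableAt one_ne_zero)]
    · rw [image_eq_zero_of_notMem_tsupport (fun h => hx (hφU h)), zero_mul, zero_mul]
  simp_rw [hD, sum_mul_horizontalGradient]
  refine ⟨?_, integral_fderiv_apply_eq_neg_integral_mul_divergence hU hY hφ hφc hφU⟩
  refine integrable_of_continuousOn_of_support_subset hφc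
    (hφ.continuous.continuousOn.mul ((hY.continuousOn_divergence hU).mono hφU)) ?_
  intro x hx
  by_contra h
  exact hx (by simp [image_eq_zero_of_notMem_tsupport h])

end Divergence

/-! ### A C¹ truncation. -/

lemma hasDerivAt_sq_max_zero (s : ℝ) :
    HasDerivAt (fun s : ℝ => (max s 0) ^ 2) (2 * max s 0) s := by
  rcases lt_trichotomy s 0 with hs | rfl | hs
  · rw [max_eq_right hs.le, mul_zero]
    refine (hasDerivAt_const s (0 : ℝ)).congr_of_eventuallyEq ?_
    filter_upwards [eventually_lt_nhds hs] with t ht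
    simp [max_eq_right ht.le]
  · rw [max_self, mul_zero, hasDerivAt_iff_isLittleO]
    simp only [max_self, ne_eq, OfNat.ofNat_ne_zero, not_false_eq_true, zero_pow, sub_zero,
      smul_zero]
    have h1 : (fun t : ℝ => (max t 0) ^ 2) =O[𝓝 0] fun t => t ^ 2 := by
      refine isBigO_of_le _ fun t => ?_
      rw [norm_pow, norm_pow]
      have : ‖max t 0‖ ≤ ‖t‖ := by
        rw [Real.norm_of_nonneg (le_max_right _ _)]
        exact max_le (le_abs_self t) (norm_nonneg t)
      gcongr
    exact h1.trans_isLittleO (isLittleO_pow_id one_lt_two)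
  · rw [max_eq_left hs.le]
    have h := (hasDerivAt_id s).pow 2
    simp only [id_eq, Nat.cast_ofNat, Nat.add_one_sub_one, pow_one, mul_one] at h
    refine h.congr_of_eventuallyEq ?_
    filter_upwards [eventually_gt_nhds hs] with t ht
    simp [max_eq_left ht.le]

/-- Test functions must be C¹, which the positive part is not; its square is, and keeps the sign
information that comparison needs. -/
lemma contDiff_sq_max_zero : ContDiff ℝ 1 (fun s : ℝ => (max s 0) ^ 2) := by
  rw [contDiff_one_iff_deriv]
  refine ⟨fun s => (hasDerivAt_sq_max_zero s).differentiableAt, ?_⟩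
  rw [funext fun s => (hasDerivAt_sq_max_zero s).deriv]
  fun_prop

/-! ### Local ellipticity and monotonicity of `A`. -/

section Operator

variable {m : ℕ}

lemma sum_partialA_eq_inner (A : EuclideanSpace ℝ (Fin m) → EuclideanSpace ℝ (Fin m))
    (ξ η : EuclideanSpace ℝ (Fin m)) :
    ∑ i, ∑ j, partialA A i j ξ * η i * η j = inner ℝ (fderiv ℝ A ξ η) η := by
  rw [clm_apply_eq_sum (fderiv ℝ A ξ) η, sum_inner]
  refine Finset.sum_congr rfl fun i _ => ?_
  rw [inner_smul_left, PiLp.inner_apply, Finset.mul_sum]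
  refine Finset.sum_congr rfl fun j _ => ?_
  simp [partialA]; ring

/-- Away from the origin the structure conditions give local uniform ellipticity. -/
lemma StructureConditions.exists_local_ellipticity
    {A : EuclideanSpace ℝ (Fin m) → EuclideanSpace ℝ (Fin m)} {p β γ κ : ℝ}
    (hS : StructureConditions A p β γ κ) (hA' : LocallyLipschitzOn {0}ᶜ (fderiv ℝ A))
    (hβ : 0 < β) (hκ : 0 ≤ κ) {ξ₀ : EuclideanSpace ℝ (Fin m)} (hξ₀ : ξ₀ ≠ 0) :
    ∃ r > 0, ∃ c > 0, ∃ M, ∃ K : NNReal, ball ξ₀ r ⊆ {0}ᶜ ∧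
      LipschitzOnWith K (fderiv ℝ A) (ball ξ₀ r) ∧ (∀ ξ ∈ ball ξ₀ r, ‖fderiv ℝ A ξ‖ ≤ M) ∧
      ∀ ξ ∈ ball ξ₀ r, ∀ η, c * ‖η‖ ^ 2 ≤ inner ℝ (fderiv ℝ A ξ η) η := by
  obtain ⟨K, t, ht, hK⟩ := hA' (mem_compl_singleton_iff.2 hξ₀)
  have hopen : ({0}ᶜ : Set (EuclideanSpace ℝ (Fin m))) ∈ 𝓝 ξ₀ :=
    isOpen_compl_singleton.mem_nhds hξ₀
  rw [nhdsWithin_eq_nhds.2 hopen] at ht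
  have hpos : 0 < κ + ‖ξ₀‖ := by have := norm_pos_iff.2 hξ₀; positivity
  set c := β * (κ + ‖ξ₀‖) ^ (p - 2) / 2 with hc
  have hc0 : 0 < c := by positivity
  have hcont : ContinuousAt (fun ξ : EuclideanSpace ℝ (Fin m) =>
      β * (κ + ‖ξ‖) ^ (p - 2)) ξ₀ :=
    continuousAt_const.mul ((continuousAt_const.add continuous_norm.continuousAt).rpow_const
      (Or.inl hpos.ne'))
  have hev : ∀ᶠ ξ in 𝓝 ξ₀, c < β * (κ + ‖ξ‖) ^ (p - 2) :=
    hcont.eventually_const_lt (by rw [hc]; linarith [half_lt_self (show 0 <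
      β * (κ + ‖ξ₀‖) ^ (p - 2) by positivity)])
  obtain ⟨r, hr, hrsub⟩ := Metric.mem_nhds_iff.1 (inter_mem (inter_mem hopen ht) hev)
  have hLip : LipschitzOnWith K (fderiv ℝ A) (ball ξ₀ r) := hK.mono fun ξ h => (hrsub h).1.2
  refine ⟨r, hr, c, hc0, ‖fderiv ℝ A ξ₀‖ + K * r, K, fun ξ h => (hrsub h).1.1, hLip, ?_, ?_⟩
  · intro ξ hξ
    have h1 := hLip.norm_sub_le hξ (mem_ball_self hr)
    have h2 : ‖ξ - ξ₀‖ ≤ r := by rw [← dist_eq_norm]; exact (mem_ball.1 hξ).le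
    have h3 : K * ‖ξ - ξ₀‖ ≤ K * r := by gcongr
    have h4 : ‖fderiv ℝ A ξ‖ ≤ ‖fderiv ℝ A ξ - fderiv ℝ A ξ₀‖ + ‖fderiv ℝ A ξ₀‖ :=
      norm_le_norm_sub_add _ _
    linarith
  · intro ξ hξ η
    -- A set of full measure is dense, so continuity of the derivative extends the almost-everywhere
    -- inequality to every point of the ball.
    have hdense := (Measure.dense_of_ae hS).open_subset_closure_inter (isOpen_ball (x := ξ₀) (ε := r)) hξ
    rw [mem_closure_iff_frequently] at hdense
    have hcts : ContinuousAt (fun ξ => inner ℝ (fderiv ℝ A ξ η) η) ξ :=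
      (((hLip.continuousOn.continuousAt (isOpen_ball.mem_nhds hξ)).clm_apply
        continuousAt_const)).inner continuousAt_const
    refine ge_of_tendsto_of_frequently hcts (hdense.mono fun ζ hζ => ?_)
    have h1 := hζ.2.1 η
    rw [sum_partialA_eq_inner] at h1
    refine le_trans ?_ h1
    gcongr
    exact (hrsub hζ.1).2.le

/-- Ellipticity of the derivative on a convex set makes the operator monotone there. -/
lemma inner_sub_nonneg_of_fderiv {F : Type*} [NormedAddCommGroup F] [InnerProductSpace ℝ F]
    {A : F → F} {s : Set F} (hs : Convex ℝ s) (hA : ∀ ξ ∈ s, DifferentiableAt ℝ A ξ)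
    (hpos : ∀ ξ ∈ s, ∀ η, 0 ≤ inner ℝ (fderiv ℝ A ξ η) η) {ξ ζ : F} (hξ : ξ ∈ s) (hζ : ζ ∈ s) :
    0 ≤ inner ℝ (A ξ - A ζ) (ξ - ζ) := by
  have hmem : ∀ t ∈ Icc (0 : ℝ) 1, ζ + t • (ξ - ζ) ∈ s := fun t ht =>
    hs.add_smul_sub_mem hζ hξ ht
  have hd : ∀ t ∈ Icc (0 : ℝ) 1, HasDerivAt (fun t : ℝ => inner ℝ (A (ζ + t • (ξ - ζ))) (ξ - ζ))
      (inner ℝ (fderiv ℝ A (ζ + t • (ξ - ζ)) (ξ - ζ)) (ξ - ζ)) t := by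
    intro t ht
    have h1 : HasDerivAt (fun t : ℝ => ζ + t • (ξ - ζ)) (ξ - ζ) t := by
      simpa using ((hasDerivAt_id t).smul_const (ξ - ζ)).const_add ζ
    have h2 := (hA _ (hmem t ht)).hasFDerivAt.comp_hasDerivAt t h1
    simpa using h2.inner ℝ (hasDerivAt_const t (ξ - ζ))
  have hmono : MonotoneOn (fun t : ℝ => inner ℝ (A (ζ + t • (ξ - ζ))) (ξ - ζ)) (Icc 0 1) :=
    monotoneOn_of_deriv_nonneg (convex_Icc 0 1)
      (fun t ht => (hd t ht).continuousAt.continuousWithinAt)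
      (fun t ht => (hd t (interior_subset ht)).differentiableAt.differentiableWithinAt)
      (fun t ht => by
        rw [(hd t (interior_subset ht)).deriv]
        exact hpos _ (hmem t (interior_subset ht)) _)
  have h := hmono (left_mem_Icc.2 zero_le_one) (right_mem_Icc.2 zero_le_one) zero_le_one
  simp only [zero_smul, add_zero, one_smul, add_sub_cancel] at h
  rw [inner_sub_left]
  linarith

end Operator

/-! ### Regularity of horizontal gradients. -/

section HorizontalGradient

variable {n m : ℕ} {X : Fin m → EuclideanSpace ℝ (Fin n) → EuclideanSpace ℝ (Fin n)}
  {U : Set (EuclideanSpace ℝ (Fin n))}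

lemma ContDiffOn.continuousOn_horizontalGradient {u : EuclideanSpace ℝ (Fin n) → ℝ}
    (hU : IsOpen U) (hX : ∀ j, ContDiffOn ℝ 1 (X j) U) (hu : ContDiffOn ℝ 1 u U) :
    ContinuousOn (horizontalGradient X u) U :=
  (PiLp.continuous_toLp 2 _).comp_continuousOn (continuousOn_pi.2 fun j =>
    (hu.continuousOn_fderiv_of_isOpen hU le_rfl).clm_apply (hX j).continuousOn)

lemma ContDiffOn.contDiffOn_horizontalGradient {u : EuclideanSpace ℝ (Fin n) → ℝ}
    (hU : IsOpen U) (hX : ∀ j, ContDiffOn ℝ 1 (X j) U) (hu : ContDiffOn ℝ 2 u U) :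
    ContDiffOn ℝ 1 (horizontalGradient X u) U := by
  rw [contDiffOn_euclidean]
  intro j
  exact (hu.fderiv_of_isOpen hU (m := 1) (by norm_num)).clm_apply (hX j)

lemma horizontalGradient_eq_zero_of_notMem_tsupport {φ : EuclideanSpace ℝ (Fin n) → ℝ}
    {x : EuclideanSpace ℝ (Fin n)} (hx : x ∉ tsupport φ) : horizontalGradient X φ x = 0 := by
  ext j
  simp [horizontalGradient, fderiv_of_notMem_tsupport ℝ hx]

lemma integrable_sum_mul_horizontalGradient
    {V : EuclideanSpace ℝ (Fin n) → EuclideanSpace ℝ (Fin m)} {φ : EuclideanSpace ℝ (Fin n) → ℝ}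
    (hU : IsOpen U) (hX : ∀ j, ContDiffOn ℝ 1 (X j) U) (hV : ContinuousOn V U)
    (hφ : ContDiff ℝ 1 φ) (hφc : HasCompactSupport φ) (hφU : tsupport φ ⊆ U) :
    Integrable fun x => ∑ j, V x j * horizontalGradient X φ x j := by
  have hg : ContinuousOn (horizontalGradient X φ) U :=
    hφ.contDiffOn.continuousOn_horizontalGradient hU hX
  refine integrable_of_continuousOn_of_support_subset hφc (ContinuousOn.mono ?_ hφU) ?_
  · exact continuousOn_finsetSum _ fun j _ =>
      ((EuclideanSpace.proj (𝕜 := ℝ) j).continuous.comp_continuousOn hV).mul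
        ((EuclideanSpace.proj (𝕜 := ℝ) j).continuous.comp_continuousOn hg)
  · intro x hx
    by_contra h
    exact hx (by simp [horizontalGradient_eq_zero_of_notMem_tsupport h])

end HorizontalGradient

/-! ### Weak comparison. -/

/-- **Weak comparison** with a strict subsolution of the form `u₂ + b`. -/
lemma IsWeakSolution.le_of_strict_subsolution {n m : ℕ}
    {X : Fin m → EuclideanSpace ℝ (Fin n) → EuclideanSpace ℝ (Fin n)}
    {A : EuclideanSpace ℝ (Fin m) → EuclideanSpace ℝ (Fin m)}
    {f : EuclideanSpace ℝ (Fin n) → ℝ → ℝ} {Ω : Set (EuclideanSpace ℝ (Fin n))}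
    {u₁ u₂ b : EuclideanSpace ℝ (Fin n) → ℝ} {L ε₀ ρ : ℝ} {y : EuclideanSpace ℝ (Fin n)}
    {S : Set (EuclideanSpace ℝ (Fin m))}
    (hΩ : IsOpen Ω) (hX : ∀ j, ContDiffOn ℝ 1 (X j) Ω)
    (hw₁ : IsWeakSolution X A f Ω u₁) (hw₂ : IsWeakSolution X A f Ω u₂)
    (hu₁ : ContDiffOn ℝ 1 u₁ Ω) (hu₂ : ContDiffOn ℝ 2 u₂ Ω) (hb : ContDiff ℝ 2 b)
    (hf : ∀ x ∈ Ω, Antitone (f x))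
    (hfL : ∀ x ∈ Ω, ∀ ε ∈ Icc 0 ε₀, |f x (u₂ x + ε) - f x (u₂ x)| ≤ L * ε)
    (hle : ∀ x ∈ Ω, u₂ x ≤ u₁ x)
    (hSo : IsOpen S) (hSc : Convex ℝ S) (hAS : ContDiffOn ℝ 1 A S)
    (hmon : ∀ ξ ∈ S, ∀ η, 0 ≤ inner ℝ (fderiv ℝ A ξ η) η)
    (hρΩ : closedBall y ρ ⊆ Ω)
    (hg₁ : ∀ x ∈ ball y ρ, horizontalGradient X u₁ x ∈ S)
    (hg₂ : ∀ x ∈ ball y ρ, horizontalGradient X u₂ x ∈ S)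
    (hgb : ∀ x ∈ ball y ρ, horizontalGradient X u₂ x + horizontalGradient X b x ∈ S)
    (hb₀ : ∀ x ∈ ball y ρ, b x ≤ ε₀)
    (hsphere : ∀ x ∈ sphere y ρ, b x < u₁ x - u₂ x)
    (hsub : ∀ x ∈ ball y ρ, L * b x < ∑ j,
      ((fderiv ℝ (fun x => A (horizontalGradient X u₂ x + horizontalGradient X b x) -
          A (horizontalGradient X u₂ x)) x (X j x)) j +
        (A (horizontalGradient X u₂ x + horizontalGradient X b x) -
          A (horizontalGradient X u₂ x)) j * divergence (X j) x)) :
    ∀ x ∈ ball y ρ, b x ≤ u₁ x - u₂ x := by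
  by_contra! hcon
  obtain ⟨x₁, hx₁, hbx₁⟩ := hcon
  set U := ball y ρ with hUdef
  have hUo : IsOpen U := isOpen_ball
  have hUΩ : U ⊆ Ω := ball_subset_closedBall.trans hρΩ
  have hXU : ∀ j, ContDiffOn ℝ 1 (X j) U := fun j => (hX j).mono hUΩ
  set g₁ := horizontalGradient X u₁ with hg₁d
  set g₂ := horizontalGradient X u₂ with hg₂d
  set k := horizontalGradient X b with hkd
  set V : EuclideanSpace ℝ (Fin n) → EuclideanSpace ℝ (Fin m) :=
    fun x => A (g₂ x + k x) - A (g₂ x) with hV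
  set D : EuclideanSpace ℝ (Fin n) → ℝ := fun x =>
    ∑ j, ((fderiv ℝ V x (X j x)) j + V x j * divergence (X j) x) with hD
  have hu₂' : ContDiffOn ℝ 1 u₂ Ω := hu₂.of_le (by norm_num)
  have hb' : ContDiff ℝ 1 b := hb.of_le (by norm_num)
  set ψ : EuclideanSpace ℝ (Fin n) → ℝ := fun x => b x - (u₁ x - u₂ x) with hψd
  have hψ : ContDiffOn ℝ 1 ψ Ω := hb'.contDiffOn.sub (hu₁.sub hu₂')
  have hgψ : ∀ x ∈ Ω, horizontalGradient X ψ x = g₂ x + k x - g₁ x := by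
    intro x hx
    have h1 := (hu₁.contDiffAt (hΩ.mem_nhds hx)).differentiableAt one_ne_zero
    have h2 := (hu₂'.contDiffAt (hΩ.mem_nhds hx)).differentiableAt one_ne_zero
    have h3 := (hb'.contDiffAt (x := x)).differentiableAt one_ne_zero
    have h4 : fderiv ℝ ψ x = fderiv ℝ b x - (fderiv ℝ u₁ x - fderiv ℝ u₂ x) :=
      (h3.hasFDerivAt.sub (h1.hasFDerivAt.sub h2.hasFDerivAt)).fderiv
    ext j
    simp only [horizontalGradient, h4, hg₁d, hg₂d, hkd, PiLp.sub_apply, PiLp.add_apply, sub_apply]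
    ring
  have hAg : ∀ {h : EuclideanSpace ℝ (Fin n) → EuclideanSpace ℝ (Fin m)},
      ContDiffOn ℝ 1 h U → (∀ x ∈ U, h x ∈ S) → ContDiffOn ℝ 1 (fun x => A (h x)) U :=
    fun hh hm => hAS.comp hh hm
  have hg₂C : ContDiffOn ℝ 1 g₂ U := (hu₂.mono hUΩ).contDiffOn_horizontalGradient hUo hXU
  have hkC : ContDiffOn ℝ 1 k U := hb.contDiffOn.contDiffOn_horizontalGradient hUo hXU
  have hVC : ContDiffOn ℝ 1 V U := (hAg (hg₂C.add hkC) hgb).sub (hAg hg₂C hg₂)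
  -- the test function
  classical
  set φ : EuclideanSpace ℝ (Fin n) → ℝ := fun x => if x ∈ U then (max (ψ x) 0) ^ 2 else 0 with hφd
  have hφU : ∀ x ∈ U, φ x = (max (ψ x) 0) ^ 2 := fun x hx => if_pos hx
  have hφ0 : ∀ x, 0 ≤ φ x := by
    intro x
    by_cases hx : x ∈ U
    · rw [hφU x hx]; positivity
    · exact (if_neg hx).ge
  set C := closedBall y ρ ∩ ψ ⁻¹' Ici 0 with hC
  have hCcl : IsClosed C :=
    (hψ.continuousOn.mono hρΩ).preimage_isClosed_of_isClosed isClosed_closedBall isClosed_Ici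
  have hCc : IsCompact C := (isCompact_closedBall y ρ).of_isClosed_subset hCcl inter_subset_left
  -- On the sphere `ψ < 0`, so the set where `ψ ≥ 0` is compact inside the open ball; this is what
  -- makes `φ` a compactly supported C¹ function after extension by zero.
  have hCU : C ⊆ U := by
    rintro x ⟨hx1, hx2⟩
    by_contra h
    have hs : x ∈ sphere y ρ := by
      rw [mem_sphere]
      exact le_antisymm hx1 (not_lt.1 h)
    have := hsphere x hs
    simp only [mem_preimage, mem_Ici, hψd] at hx2
    linarith
  have hsuppC : Function.support φ ⊆ C := by
    intro x hx
    have hxU : x ∈ U := by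
      by_contra h
      exact hx (if_neg h)
    refine ⟨ball_subset_closedBall hxU, ?_⟩
    rw [mem_preimage, mem_Ici]
    by_contra! h
    exact hx (by rw [hφU x hxU, max_eq_right h.le]; simp)
  have htC : tsupport φ ⊆ C := closure_minimal hsuppC hCcl
  have htU : tsupport φ ⊆ U := htC.trans hCU
  have hφc : HasCompactSupport φ := hCc.of_isClosed_subset (isClosed_tsupport φ) htC
  have hφC1 : ContDiff ℝ 1 φ := by
    rw [contDiff_iff_contDiffAt]
    intro x
    by_cases hx : x ∈ U
    · refine (contDiff_sq_max_zero.contDiffAt.comp x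
        (hψ.contDiffAt (hΩ.mem_nhds (hUΩ hx)))).congr_of_eventuallyEq ?_
      filter_upwards [hUo.mem_nhds hx] with z hz
      exact hφU z hz
    · exact contDiffAt_const.congr_of_eventuallyEq
        (notMem_tsupport_iff_eventuallyEq.1 fun h => hx (htU h))
  have hgφ : ∀ x ∈ U, horizontalGradient X φ x = (2 * max (ψ x) 0) • (g₂ x + k x - g₁ x) := by
    intro x hx
    have h1 := ((hψ.contDiffAt (hΩ.mem_nhds (hUΩ hx))).differentiableAt one_ne_zero).hasFDerivAt
    have h2 : fderiv ℝ φ x = (2 * max (ψ x) 0) • fderiv ℝ ψ x := by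
      have h3 : φ =ᶠ[𝓝 x] fun z => (max (ψ z) 0) ^ 2 := by
        filter_upwards [hUo.mem_nhds hx] with z hz
        exact hφU z hz
      rw [h3.fderiv_eq]
      exact ((hasDerivAt_sq_max_zero (ψ x)).comp_hasFDerivAt x h1).fderiv
    rw [← hgψ x (hUΩ hx)]
    ext j
    simp [horizontalGradient, h2]
  -- the weak formulations
  have hzero : ∀ (B : EuclideanSpace ℝ (Fin n) → EuclideanSpace ℝ (Fin m)), ∀ x, x ∉ Ω →
      ∑ j, B x j * horizontalGradient X φ x j = 0 := fun B x hx => by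
    simp [horizontalGradient_eq_zero_of_notMem_tsupport fun h => hx (hUΩ (htU h))]
  have hzero' : ∀ (F : EuclideanSpace ℝ (Fin n) → ℝ), ∀ x, x ∉ Ω → F x * φ x = 0 := fun F x hx => by
    simp [image_eq_zero_of_notMem_tsupport fun h => hx (hUΩ (htU h))]
  have e₁ := hw₁.2 φ hφC1 hφc (htU.trans hUΩ)
  have e₂ := hw₂.2 φ hφC1 hφc (htU.trans hUΩ)
  rw [setIntegral_eq_integral_of_forall_compl_eq_zero (hzero fun x => A (g₁ x)),
    setIntegral_eq_integral_of_forall_compl_eq_zero (hzero' _)] at e₁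
  rw [setIntegral_eq_integral_of_forall_compl_eq_zero (hzero fun x => A (g₂ x)),
    setIntegral_eq_integral_of_forall_compl_eq_zero (hzero' _)] at e₂
  obtain ⟨iD, e₃⟩ : Integrable (fun x => φ x * D x) ∧
      ∫ x, ∑ j, V x j * horizontalGradient X φ x j = -∫ x, φ x * D x :=
    integral_sum_mul_horizontalGradient hUo hXU hVC hφC1 hφc htU
  have hg₁C : ContinuousOn (fun x => A (g₁ x)) U :=
    hAS.continuousOn.comp ((hu₁.mono hUΩ).continuousOn_horizontalGradient hUo hXU) hg₁
  have i₁ := integrable_sum_mul_horizontalGradient hUo hXU hg₁C hφC1 hφc htU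
  have i₂ := integrable_sum_mul_horizontalGradient hUo hXU (hAg hg₂C hg₂).continuousOn hφC1 hφc htU
  have i₃ := integrable_sum_mul_horizontalGradient hUo hXU hVC.continuousOn hφC1 hφc htU
  have hfint : ∀ u : EuclideanSpace ℝ (Fin n) → ℝ, IsWeakSolution X A f Ω u →
      Integrable fun x => f x (u x) * φ x := by
    intro u hu
    have h1 : IntegrableOn (fun x => f x (u x)) (tsupport φ) :=
      hu.1.integrableOn_compact_subset (htU.trans hUΩ) hφc
    refine (integrableOn_iff_integrable_of_support_subset (s := tsupport φ) ?_).1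
      (h1.mul_continuousOn hφC1.continuous.continuousOn hφc)
    intro x hx
    by_contra h
    exact hx (by simp [image_eq_zero_of_notMem_tsupport h])
  have j₁ := hfint u₁ hw₁
  have j₂ := hfint u₂ hw₂
  -- The flux is `A (X (u₂ + b)) - A (X u₁)`, and `X φ` is `2 ψ⁺` times the difference of the
  -- arguments, so monotonicity of `A` on `S` applies. Only `V` is integrated by parts; the other
  -- two fluxes are replaced through the weak equations.
  have hpos : 0 ≤ ∫ x, (∑ j, V x j * horizontalGradient X φ x j +
      ∑ j, A (g₂ x) j * horizontalGradient X φ x j -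
      ∑ j, A (g₁ x) j * horizontalGradient X φ x j) := by
    refine integral_nonneg fun x => ?_
    rw [Pi.zero_apply, ← Finset.sum_add_distrib, ← Finset.sum_sub_distrib]
    by_cases hx : x ∈ U
    · have h1 := inner_sub_nonneg_of_fderiv hSc
        (fun ξ hξ => (hAS.contDiffAt (hSo.mem_nhds hξ)).differentiableAt one_ne_zero) hmon
        (hgb x hx) (hg₁ x hx)
      have h2 : ∑ j, (V x j * horizontalGradient X φ x j + A (g₂ x) j * horizontalGradient X φ x j -
          A (g₁ x) j * horizontalGradient X φ x j) =
          2 * max (ψ x) 0 * inner ℝ (A (g₂ x + k x) - A (g₁ x)) (g₂ x + k x - g₁ x) := by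
        rw [PiLp.inner_apply, Finset.mul_sum]
        refine Finset.sum_congr rfl fun j _ => ?_
        rw [hgφ x hx]
        simp [hV]
        ring
      rw [h2]
      have := le_max_right (ψ x) 0
      positivity
    · simp [horizontalGradient_eq_zero_of_notMem_tsupport fun h => hx (htU h)]
  have hsplit := integral_sub (i₃.add i₂) i₁
  simp only [Pi.add_apply] at hsplit
  rw [hsplit, integral_add i₃ i₂, e₁, e₂, e₃] at hpos
  -- strictness of the subsolution
  have iLb : Integrable fun x => L * b x * φ x :=
    ((continuous_const.mul hb.continuous).mul hφC1.continuous).integrable_of_hasCompactSupport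
      hφc.mul_left
  have hstrict : 0 < ∫ x, (φ x * D x - L * b x * φ x) := by
    have h0 : ∀ x, x ∉ U → φ x = 0 := fun x hx => if_neg hx
    have hi : Integrable fun x => φ x * D x - L * b x * φ x := iD.sub iLb
    refine (integral_pos_iff_support_of_nonneg ?_ hi).2 ?_
    · intro x
      simp only [Pi.zero_apply]
      by_cases hx : x ∈ U
      · nlinarith [hφ0 x, hsub x hx, mul_nonneg (hφ0 x) (sub_pos.2 (hsub x hx)).le]
      · simp [h0 x hx]
    · have hsupp : Function.support φ ⊆ Function.support fun x => φ x * D x - L * b x * φ x := by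
        intro x hx
        have hxU : x ∈ U := by by_contra h; exact hx (h0 x h)
        have h1 : φ x * D x - L * b x * φ x = φ x * (D x - L * b x) := by ring
        rw [Function.mem_support, h1]
        exact mul_ne_zero hx (sub_pos.2 (hsub x hxU)).ne'
      refine lt_of_lt_of_le ?_ (measure_mono hsupp)
      refine (hφC1.continuous.isOpen_support).measure_pos _ ⟨x₁, ?_⟩
      rw [Function.mem_support, hφU x₁ hx₁]
      have : 0 < ψ x₁ := by simp only [hψd]; linarith
      rw [max_eq_left this.le]
      positivity
  -- Where `φ > 0`, `0 ≤ u₁ - u₂ < b ≤ ε₀`, so `f x (u₁ x) ≥ f x (u₂ x + b x) ≥ f x (u₂ x) - L b x`.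
  -- With `hpos` this gives `∫ φ D ≤ ∫ L b φ`, against `hstrict`.
  have hcomp : ∫ x, (f x (u₂ x) * φ x - f x (u₁ x) * φ x) ≤ ∫ x, L * b x * φ x := by
    refine integral_mono (j₂.sub j₁) iLb fun x => ?_
    by_cases hx : x ∈ U ∧ 0 < ψ x
    · obtain ⟨hxU, hψx⟩ := hx
      have hw := hle x (hUΩ hxU)
      simp only [hψd] at hψx
      have h1 := hf x (hUΩ hxU) (show u₁ x ≤ u₂ x + b x by linarith)
      have h2 := (abs_le.1 (hfL x (hUΩ hxU) (b x) ⟨by linarith, hb₀ x hxU⟩)).1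
      nlinarith [hφ0 x]
    · have : φ x = 0 := by
        by_cases hxU : x ∈ U
        · have h : ψ x ≤ 0 := by by_contra! h; exact hx ⟨hxU, h⟩
          rw [hφU x hxU, max_eq_right h]; simp
        · exact if_neg hxU
      simp [this]
  rw [integral_sub iD iLb] at hstrict
  rw [integral_sub j₂ j₁] at hcomp
  linarith

/-! ### The exponential barrier and Hopf's lemma. -/

lemma hasFDerivAt_exp_neg_mul_norm_sq {E : Type*} [NormedAddCommGroup E] [InnerProductSpace ℝ E]
    (α : ℝ) (x₀ x : E) :
    HasFDerivAt (fun z => Real.exp (-α * ‖z - x₀‖ ^ 2))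
      ((-2 * α * Real.exp (-α * ‖x - x₀‖ ^ 2)) • innerSL ℝ (x - x₀)) x := by
  have h := (((hasFDerivAt_id (𝕜 := ℝ) x).sub_const x₀).norm_sq.const_mul (-α)).exp
  refine h.congr_fderiv ?_
  ext v
  simp
  ring

/-- Divergence of the perturbation of the operator caused by the exponential barrier
`ε exp (-α |x - x₀|²)`, whose horizontal gradient is `-2 α ε exp (-α |x - x₀|²) q`. -/
lemma barrier_divergence_lower_bound {n m : ℕ}
    {X : Fin m → EuclideanSpace ℝ (Fin n) → EuclideanSpace ℝ (Fin n)}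
    {A : EuclideanSpace ℝ (Fin m) → EuclideanSpace ℝ (Fin m)}
    {g q : EuclideanSpace ℝ (Fin n) → EuclideanSpace ℝ (Fin m)} {x x₀ : EuclideanSpace ℝ (Fin n)}
    {S : Set (EuclideanSpace ℝ (Fin m))} {α ε c M : ℝ} {K : NNReal}
    (hα : 0 ≤ α) (hε : 0 ≤ ε) (hM : 0 ≤ M) (hS : Convex ℝ S)
    (hA : ∀ ξ ∈ S, DifferentiableAt ℝ A ξ) (hAM : ∀ ξ ∈ S, ‖fderiv ℝ A ξ‖ ≤ M)
    (hAL : LipschitzOnWith K (fderiv ℝ A) S) (hKM : K ≤ M)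
    (hAc : ∀ ξ ∈ S, ∀ η, c * ‖η‖ ^ 2 ≤ inner ℝ (fderiv ℝ A ξ η) η)
    (hg : DifferentiableAt ℝ g x) (hq : DifferentiableAt ℝ q x)
    (hgM : ‖fderiv ℝ g x‖ ≤ M) (hqM' : ‖fderiv ℝ q x‖ ≤ M) (hqM : ‖q x‖ ≤ M)
    (hXM : ∀ j, ‖X j x‖ ≤ M) (hdM : ∀ j, |divergence (X j) x| ≤ M)
    (hqX : ∀ j, q x j = inner ℝ (x - x₀) (X j x)) (hgS : g x ∈ S)
    (hgkS : g x + (-2 * α * ε * Real.exp (-α * ‖x - x₀‖ ^ 2)) • q x ∈ S) :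
    ε * Real.exp (-α * ‖x - x₀‖ ^ 2) *
        (4 * α ^ 2 * c * ‖q x‖ ^ 2 - 2 * α * (m * (M ^ 4 + 2 * M ^ 3))) ≤
      ∑ j, ((fderiv ℝ (fun z =>
        A (g z + (-2 * α * ε * Real.exp (-α * ‖z - x₀‖ ^ 2)) • q z) - A (g z)) x (X j x)) j +
        (A (g x + (-2 * α * ε * Real.exp (-α * ‖x - x₀‖ ^ 2)) • q x) - A (g x)) j *
          divergence (X j) x) := by
  set e := Real.exp (-α * ‖x - x₀‖ ^ 2) with he
  have he0 : 0 < e := Real.exp_pos _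
  set ξ := g x + (-2 * α * ε * e) • q x with hξ
  set T := fderiv ℝ A ξ with hT
  have hTM : ‖T‖ ≤ M := hAM ξ hgkS
  have hs : ‖ξ - g x‖ ≤ 2 * α * ε * e * M := by
    rw [hξ, add_sub_cancel_left, norm_smul, Real.norm_eq_abs,
      show -2 * α * ε * e = -(2 * α * ε * e) by ring, abs_neg, abs_of_nonneg (by positivity)]
    gcongr
  have hV : ‖A ξ - A (g x)‖ ≤ M * (2 * α * ε * e * M) :=
    (hS.norm_image_sub_le_of_norm_fderiv_le hA hAM hgS hgkS).trans (by gcongr)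
  -- The Lipschitz bound on the derivative of `A` is essential here: this error then carries the
  -- factor `α ε e`, so the leading term `α² ε e` absorbs it uniformly in `ε`.
  have hTT : ‖T - fderiv ℝ A (g x)‖ ≤ M * (2 * α * ε * e * M) :=
    (hAL.norm_sub_le hgkS hgS).trans (by gcongr)
  have hcoef : HasFDerivAt (fun z => -2 * α * ε * Real.exp (-α * ‖z - x₀‖ ^ 2))
      ((4 * α ^ 2 * ε * e) • innerSL ℝ (x - x₀)) x := by
    refine ((hasFDerivAt_exp_neg_mul_norm_sq α x₀ x).const_mul (-2 * α * ε)).congr_fderiv ?_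
    rw [smul_smul]
    congr 1
    ring
  have hderiv : ∀ v, fderiv ℝ (fun z =>
      A (g z + (-2 * α * ε * Real.exp (-α * ‖z - x₀‖ ^ 2)) • q z) - A (g z)) x v =
      (T - fderiv ℝ A (g x)) (fderiv ℝ g x v) + (-2 * α * ε * e) • T (fderiv ℝ q x v) +
        (4 * α ^ 2 * ε * e * inner ℝ (x - x₀) v) • T (q x) := by
    intro v
    have h1 := hg.hasFDerivAt.add (hcoef.smul hq.hasFDerivAt)
    have h2 : HasFDerivAt A T (g x + (-2 * α * ε * Real.exp (-α * ‖x - x₀‖ ^ 2)) • q x) :=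
      (hA ξ hgkS).hasFDerivAt
    have h3 := (h2.comp x h1).sub ((hA _ hgS).hasFDerivAt.comp x hg.hasFDerivAt)
    have h4 := h3.fderiv
    have h5 : (fun z => A (g z + (-2 * α * ε * Real.exp (-α * ‖z - x₀‖ ^ 2)) • q z) - A (g z)) =
      (A ∘ (g + (fun z => -2 * α * ε * Real.exp (-α * ‖z - x₀‖ ^ 2)) • q)) - A ∘ g := rfl
    rw [h5, h4, ← he]
    simp only [sub_apply, add_apply, smul_apply, ContinuousLinearMap.comp_apply,
      ContinuousLinearMap.smulRight_apply, innerSL_apply_apply, map_add, map_smul, smul_eq_mul]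
    module
  have hcoord : ∀ (v : EuclideanSpace ℝ (Fin m)) j, |v j| ≤ ‖v‖ := fun v j => PiLp.norm_apply_le v j
  -- Besides the leading term there are three errors: the change of the derivative of `A` (the `M ^
  -- 4`), the derivative of `q`, and the divergence of `X j` (one `M ^ 3` each).
  have hterm : ∀ j, 4 * α ^ 2 * ε * e * ((T (q x)) j * q x j) -
      2 * α * ε * e * (M ^ 4 + 2 * M ^ 3) ≤
      (fderiv ℝ (fun z =>
        A (g z + (-2 * α * ε * Real.exp (-α * ‖z - x₀‖ ^ 2)) • q z) - A (g z)) x (X j x)) j +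
        (A ξ - A (g x)) j * divergence (X j) x := by
    intro j
    rw [hderiv, ← hqX]
    have h1 : |((T - fderiv ℝ A (g x)) (fderiv ℝ g x (X j x))) j| ≤
        M * (2 * α * ε * e * M) * (M * M) := by
      refine (hcoord _ j).trans ((ContinuousLinearMap.le_opNorm _ _).trans ?_)
      gcongr
      exact (ContinuousLinearMap.le_opNorm _ _).trans
        (mul_le_mul hgM (hXM j) (norm_nonneg _) hM)
    have h2 : |(T (fderiv ℝ q x (X j x))) j| ≤ M * (M * M) := by
      refine (hcoord _ j).trans ((ContinuousLinearMap.le_opNorm _ _).trans ?_)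
      gcongr
      exact (ContinuousLinearMap.le_opNorm _ _).trans
        (mul_le_mul hqM' (hXM j) (norm_nonneg _) hM)
    have h3 : |(A ξ - A (g x)) j * divergence (X j) x| ≤ M * (2 * α * ε * e * M) * M := by
      rw [abs_mul]
      exact mul_le_mul ((hcoord _ j).trans hV) (hdM j) (abs_nonneg _) (by positivity)
    have h2' : 2 * α * ε * e * (T (fderiv ℝ q x (X j x))) j ≤ 2 * α * ε * e * (M * (M * M)) := by
      gcongr
      exact (abs_le.1 h2).2
    simp only [PiLp.add_apply, PiLp.smul_apply, smul_eq_mul]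
    have h1' := (abs_le.1 h1).1
    have h3' := (abs_le.1 h3).1
    linarith
  refine le_trans ?_ (Finset.sum_le_sum fun j _ => hterm j)
  rw [Finset.sum_sub_distrib, ← Finset.mul_sum]
  have hin : ∑ j, (T (q x)) j * q x j = inner ℝ (T (q x)) (q x) := by
    rw [PiLp.inner_apply]
    exact Finset.sum_congr rfl fun j _ => by simp [mul_comm]
  rw [hin]
  have h4 : 4 * α ^ 2 * ε * e * (c * ‖q x‖ ^ 2) ≤ 4 * α ^ 2 * ε * e * inner ℝ (T (q x)) (q x) := by
    gcongr
    exact hAc ξ hgkS _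
  simp only [Finset.sum_const, Finset.card_univ, Fintype.card_fin, nsmul_eq_mul]
  linarith

/-- Halving an exterior ball makes it touch the set only at the contact point. -/
lemma norm_sub_midpoint_lt {E : Type*} [NormedAddCommGroup E] [InnerProductSpace ℝ E]
    {z z' x : E} (h : dist z x ≤ dist z' x) (hne : z' ≠ z) :
    ‖z - (z + (1 / 2 : ℝ) • (x - z))‖ < ‖z' - (z + (1 / 2 : ℝ) • (x - z))‖ := by
  set a := z' - z with ha
  set v := x - z with hv
  have ha0 : 0 < ‖a‖ := norm_pos_iff.2 (sub_ne_zero.2 hne)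
  rw [dist_eq_norm, dist_eq_norm, norm_sub_rev z, ← hv, show z' - x = a - v by simp [ha, hv]] at h
  rw [show z - (z + (1 / 2 : ℝ) • v) = -((1 / 2 : ℝ) • v) by abel,
    show z' - (z + (1 / 2 : ℝ) • v) = a - (1 / 2 : ℝ) • v by rw [ha]; abel]
  refine lt_of_pow_lt_pow_left₀ 2 (norm_nonneg _) ?_
  -- This says `2 ⟨a, v⟩ ≤ ‖a‖²`, hence `‖a - v/2‖² ≥ ‖v/2‖² + ‖a‖²/2`.
  have h2 : ‖v‖ ^ 2 ≤ ‖a - v‖ ^ 2 := by gcongr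
  rw [norm_sub_sq_real a] at h2 ⊢
  rw [norm_neg, inner_smul_right]
  nlinarith [sq_pos_of_pos ha0]

set_option maxHeartbeats 1600000 in
/-- **Hopf's lemma**: the coefficient fields are tangent to the contact set of `u₁ ≥ u₂`. -/
lemma IsWeakSolution.tangentTo_contactSet {n m : ℕ}
    {X : Fin m → EuclideanSpace ℝ (Fin n) → EuclideanSpace ℝ (Fin n)}
    {A : EuclideanSpace ℝ (Fin m) → EuclideanSpace ℝ (Fin m)} {p β γ κ : ℝ}
    {f : EuclideanSpace ℝ (Fin n) → ℝ → ℝ} {Ω : Set (EuclideanSpace ℝ (Fin n))}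
    {u₁ u₂ : EuclideanSpace ℝ (Fin n) → ℝ} {L ε₀ : ℝ}
    (hΩ : IsOpen Ω) (hX : ∀ j, ContDiffOn ℝ ∞ (X j) Ω)
    (hA : DifferentiableOn ℝ A {0}ᶜ) (hA' : LocallyLipschitzOn {0}ᶜ (fderiv ℝ A))
    (hS : StructureConditions A p β γ κ) (hβ : 0 < β) (hκ : 0 ≤ κ)
    (hw₁ : IsWeakSolution X A f Ω u₁) (hw₂ : IsWeakSolution X A f Ω u₂)
    (hu₁ : ContDiffOn ℝ 1 u₁ Ω) (hu₂ : ContDiffOn ℝ 2 u₂ Ω)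
    (hf : ∀ x ∈ Ω, Antitone (f x)) (hL : 0 < L) (hε₀ : 0 < ε₀)
    (hfL : ∀ x ∈ Ω, ∀ ε ∈ Icc 0 ε₀, |f x (u₂ x + ε) - f x (u₂ x)| ≤ L * ε)
    (hXu₂ : ∀ x ∈ Ω, horizontalGradient X u₂ x ≠ 0)
    (hle : ∀ x ∈ Ω, u₂ x ≤ u₁ x) (j : Fin m) :
    TangentTo (X j) {x ∈ Ω | u₁ x = u₂ x} := by
  rintro z ⟨hzΩ, hz⟩ x hx
  by_contra hne
  have hX1 : ∀ j, ContDiffOn ℝ 1 (X j) Ω := fun j => (hX j).of_le (by exact_mod_cast le_top)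
  have hΩz : Ω ∈ 𝓝 z := hΩ.mem_nhds hzΩ
  have hu₂' : ContDiffOn ℝ 1 u₂ Ω := hu₂.of_le (by norm_num)
  set x₀ := z + (1 / 2 : ℝ) • (x - z) with hx₀
  set R := ‖z - x₀‖ with hR
  have hsep : ∀ y ∈ Ω, y ≠ z → ‖y - x₀‖ ≤ R → 0 < u₁ y - u₂ y := by
    intro y hy hyz hyR
    refine lt_of_le_of_ne (sub_nonneg.2 (hle y hy)) fun h => ?_
    exact absurd (norm_sub_midpoint_lt (hx y ⟨hy, (sub_eq_zero.1 h.symm)⟩) hyz) (not_lt.2 hyR)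
  set q : EuclideanSpace ℝ (Fin n) → EuclideanSpace ℝ (Fin m) :=
    fun y => WithLp.toLp 2 fun j => inner ℝ (y - x₀) (X j y) with hq
  have hqX : ∀ y j, q y j = inner ℝ (y - x₀) (X j y) := fun y j => rfl
  have hqC : ContDiffOn ℝ 1 q Ω := by
    rw [contDiffOn_euclidean]
    exact fun j => (contDiffOn_id.sub contDiffOn_const).inner ℝ (hX1 j)
  have hqzj : q z j ≠ 0 := by
    rw [hqX, show z - x₀ = -((1 / 2 : ℝ) • (x - z)) by rw [hx₀]; abel, inner_neg_left,
      inner_smul_left, real_inner_comm]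
    simpa using hne
  have hqz : 0 < ‖q z‖ := norm_pos_iff.2 fun h => hqzj (by rw [h]; rfl)
  have hdiff₁ := ((hu₁.contDiffAt hΩz).differentiableAt one_ne_zero).hasFDerivAt
  have hdiff₂ := ((hu₂'.contDiffAt hΩz).differentiableAt one_ne_zero).hasFDerivAt
  have hmin : IsLocalMin (u₁ - u₂) z := by
    filter_upwards [hΩz] with y hy
    simpa [hz] using hle y hy
  have hgrad : fderiv ℝ u₁ z = fderiv ℝ u₂ z :=
    sub_eq_zero.1 (hmin.hasFDerivAt_eq_zero (hdiff₁.sub hdiff₂))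
  set ξ₀ := horizontalGradient X u₂ z with hξ₀
  have hξ₁ : horizontalGradient X u₁ z = ξ₀ := by
    simp only [hξ₀, horizontalGradient, hgrad]
  obtain ⟨r, hr, c, hc, MA, K, hball, hLip, hMA, hcoer⟩ :=
    hS.exists_local_ellipticity hA' hβ hκ (hXu₂ z hzΩ)
  have hAd : ∀ ξ ∈ ball ξ₀ r, DifferentiableAt ℝ A ξ := fun ξ hξ =>
    hA.differentiableAt (isOpen_compl_singleton.mem_nhds (hball hξ))
  have hAC : ContDiffOn ℝ 1 A (ball ξ₀ r) := by
    rw [show (1 : WithTop ℕ∞) = 0 + 1 by simp, contDiffOn_succ_iff_fderiv_of_isOpen isOpen_ball]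
    exact ⟨fun ξ hξ => (hAd ξ hξ).differentiableWithinAt, by simp,
      contDiffOn_zero.2 hLip.continuousOn⟩
  have hg₂C : ContDiffOn ℝ 1 (horizontalGradient X u₂) Ω :=
    hu₂.contDiffOn_horizontalGradient hΩ hX1
  have hg₁C : ContinuousOn (horizontalGradient X u₁) Ω :=
    hu₁.continuousOn_horizontalGradient hΩ hX1
  -- All quantities needing a local bound are packed into one continuous map, so that a single `M`
  -- controls them.
  set F := fun y => (fderiv ℝ (horizontalGradient X u₂) y, fderiv ℝ q y, q y,
    (fun j => X j y), fun j => divergence (X j) y) with hF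
  have hFc : ContinuousAt F z := by
    refine ContinuousOn.continuousAt ?_ hΩz
    refine (hg₂C.continuousOn_fderiv_of_isOpen hΩ le_rfl).prodMk
      ((hqC.continuousOn_fderiv_of_isOpen hΩ le_rfl).prodMk (hqC.continuousOn.prodMk
        ((continuousOn_pi.2 fun j => (hX1 j).continuousOn).prodMk
          (continuousOn_pi.2 fun j => (hX1 j).continuousOn_divergence hΩ))))
  have hev : ∀ᶠ y in 𝓝 z, y ∈ Ω ∧ horizontalGradient X u₁ y ∈ ball ξ₀ r ∧
      horizontalGradient X u₂ y ∈ ball ξ₀ (r / 2) ∧ ‖q z‖ / 2 < ‖q y‖ ∧ ‖F y‖ < ‖F z‖ + 1 := by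
    filter_upwards [hΩz,
      (hg₁C.continuousAt hΩz).eventually_mem
        (isOpen_ball.mem_nhds (by rw [hξ₁]; exact mem_ball_self hr)),
      (hg₂C.continuousOn.continuousAt hΩz).eventually_mem (ball_mem_nhds _ (half_pos hr)),
      (hqC.continuousOn.continuousAt hΩz).norm.eventually_const_lt (half_lt_self hqz),
      hFc.norm.eventually_lt_const (lt_add_one _)] with y h1 h2 h3 h4 h5
    exact ⟨h1, h2, h3, h4, h5⟩
  obtain ⟨ρ, hρ, hρP⟩ := nhds_basis_closedBall.eventually_iff.1 hev
  have hρΩ : closedBall z ρ ⊆ Ω := fun y hy => (hρP hy).1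
  have hbP : ∀ y ∈ ball z ρ, _ := fun y hy => hρP (ball_subset_closedBall hy)
  set M := max (‖F z‖ + 1) (max MA K) with hM
  have hM0 : 0 ≤ M := le_max_of_le_left (by positivity)
  have hMF : ∀ y ∈ ball z ρ, ‖F y‖ ≤ M := fun y hy => (hbP y hy).2.2.2.2.le.trans (le_max_left _ _)
  set Q := (m : ℝ) * (M ^ 4 + 2 * M ^ 3) with hQ
  have hQ0 : 0 ≤ Q := by positivity
  -- Multiplying by `α` gives `4 α² c ‖q‖² - 2 α Q ≥ α (L + 1) ≥ L + 1`, which beats `L b` with room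
  -- to spare. The choice precedes that of `ε`.
  obtain ⟨α, hα1, hα⟩ : ∃ α : ℝ, 1 ≤ α ∧ 2 * Q + L + 1 ≤ α * (4 * c * (‖q z‖ / 2) ^ 2) := by
    have hd : 0 < 4 * c * (‖q z‖ / 2) ^ 2 := by positivity
    refine ⟨max 1 ((2 * Q + L + 1) / (4 * c * (‖q z‖ / 2) ^ 2)), le_max_left _ _, ?_⟩
    rw [← div_le_iff₀ hd]
    exact le_max_right _ _
  have hα0 : 0 < α := by linarith
  obtain ⟨μ, hμ, hμw⟩ : ∃ μ, 0 < μ ∧ ∀ y ∈ sphere z ρ ∩ closedBall x₀ R, μ ≤ u₁ y - u₂ y := by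
    have hsub : sphere z ρ ∩ closedBall x₀ R ⊆ Ω :=
      inter_subset_left.trans (sphere_subset_closedBall.trans hρΩ)
    refine ((isCompact_sphere z ρ).inter_right isClosed_closedBall).exists_forall_le'
      ((hu₁.continuousOn.sub hu₂.continuousOn).mono hsub) fun y hy => ?_
    refine hsep y (hsub hy) ?_ (by rw [← dist_eq_norm]; exact hy.2)
    rintro rfl
    have := mem_sphere.1 hy.1
    rw [dist_self] at this
    exact hρ.ne this
  -- The three bounds keep `b` in the range of the one-sided Lipschitz condition on `f`, below `u₁ -
  -- u₂` on the part of the sphere inside the exterior ball, and `X (u₂ + b)` in the ellipticity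
  -- ball.
  obtain ⟨ε, hε, hεε₀, hεμ, hεr⟩ : ∃ ε > 0, ε ≤ ε₀ ∧ ε < μ ∧ 2 * α * ε * M < r / 2 := by
    refine ⟨min ε₀ (min (μ / 2) (r / 4 / (2 * α * M + 1))), by positivity, min_le_left _ _, ?_, ?_⟩
    · exact ((min_le_right _ _).trans (min_le_left _ _)).trans_lt (half_lt_self hμ)
    · set ε := min ε₀ (min (μ / 2) (r / 4 / (2 * α * M + 1))) with hεd
      have h1 : ε ≤ r / 4 / (2 * α * M + 1) := (min_le_right _ _).trans (min_le_right _ _)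
      have h2 : 0 < ε := by positivity
      rw [le_div_iff₀ (by positivity)] at h1
      linarith
  set E : EuclideanSpace ℝ (Fin n) → ℝ := fun y => Real.exp (-α * ‖y - x₀‖ ^ 2) with hE
  have hE1 : ∀ y, E y ≤ 1 := fun y => Real.exp_le_one_iff.2 (by
    have := mul_nonneg hα0.le (sq_nonneg ‖y - x₀‖); linarith)
  have hE0 : ∀ y, 0 < E y := fun y => Real.exp_pos _
  set b : EuclideanSpace ℝ (Fin n) → ℝ := fun y => ε * (E y - E z) with hb
  have hbC : ContDiff ℝ 2 b := contDiff_const.mul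
    (((contDiff_const.mul ((contDiff_id.sub contDiff_const).norm_sq ℝ)).exp).sub contDiff_const)
  have hbE : ∀ y, b y ≤ ε * E y := fun y => by
    simp only [hb]; nlinarith [hE0 z]
  have hbd : ∀ y, HasFDerivAt b (ε • ((-2 * α * E y) • innerSL ℝ (y - x₀))) y := fun y =>
    ((hasFDerivAt_exp_neg_mul_norm_sq α x₀ y).sub_const (E z)).const_mul ε
  have hbg : horizontalGradient X b = fun y => (-2 * α * ε * E y) • q y := by
    funext y
    ext i
    simp only [horizontalGradient, (hbd y).fderiv, PiLp.smul_apply, hqX, smul_eq_mul, smul_apply,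
      innerSL_apply_apply]
    ring
  have hgb : ∀ y ∈ ball z ρ, horizontalGradient X u₂ y + (-2 * α * ε * E y) • q y ∈ ball ξ₀ r := by
    intro y hy
    have h1 : ‖q y‖ ≤ M := ((norm_fst_le _).trans ((norm_snd_le _).trans (norm_snd_le (F y)))).trans
      (hMF y hy)
    have h2 : ‖(-2 * α * ε * E y) • q y‖ ≤ 2 * α * ε * M := by
      rw [norm_smul, Real.norm_eq_abs, show -2 * α * ε * E y = -(2 * α * ε * E y) by ring, abs_neg,
        abs_of_nonneg (by have := hE0 y; positivity)]
      have : 2 * α * ε * E y ≤ 2 * α * ε * 1 := by gcongr; exact hE1 y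
      rw [mul_one] at this
      gcongr
    have h3 := (hbP y hy).2.2.1
    rw [mem_ball, dist_eq_norm] at h3 ⊢
    rw [add_sub_right_comm]
    exact (norm_add_le _ _).trans_lt (by linarith)
  have key := IsWeakSolution.le_of_strict_subsolution (b := b) (y := z) (ρ := ρ) (S := ball ξ₀ r)
    hΩ hX1 hw₁ hw₂ hu₁ hu₂ hbC hf hfL hle isOpen_ball (convex_ball _ _) hAC
    (fun ξ hξ η => le_trans (by positivity) (hcoer ξ hξ η)) hρΩ (fun y hy => (hbP y hy).2.1)
    (fun y hy => ball_subset_ball (half_le_self hr.le) (hbP y hy).2.2.1)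
    (by rw [hbg]; exact hgb) (fun y hy => ?_) (fun y hy => ?_) (fun y hy => ?_)
  -- Both `u₁ - u₂` and `b` vanish at `z`, so comparison yields a minimum of their difference. There
  -- the gradient of `b` must vanish, yet along `X j` it is `-2 α ε E(z) q_j(z) ≠ 0`.
  · have hmin' : IsLocalMin ((u₁ - u₂) - b) z := by
      filter_upwards [ball_mem_nhds z hρ] with y hy
      have := key y hy
      simp only [Pi.sub_apply, hz, hb, sub_self, mul_zero] at this ⊢
      linarith
    have h0 := hmin'.hasFDerivAt_eq_zero ((hdiff₁.sub hdiff₂).sub (hbd z))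
    rw [hgrad, sub_self, zero_sub, neg_eq_zero] at h0
    have h1 := congrArg (fun T => T (X j z)) h0
    simp only [smul_apply, innerSL_apply_apply, zero_apply, smul_eq_mul, ← hqX] at h1
    have := (hE0 z).ne'
    simp [hε.ne', hα0.ne', this, hqzj] at h1
  · have := hbE y
    nlinarith [hE1 y]
  · by_cases hyR : y ∈ closedBall x₀ R
    · refine lt_of_lt_of_le ?_ (hμw y ⟨hy, hyR⟩)
      have := hbE y
      nlinarith [hE1 y]
    -- Outside the exterior ball the barrier is negative, so `u₁ ≥ u₂` suffices; comparison can thus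
    -- be run on a full ball around `z`.
    · rw [mem_closedBall, not_le, dist_eq_norm] at hyR
      have h1 : E y < E z := by
        refine Real.exp_lt_exp.2 ?_
        have : R ^ 2 < ‖y - x₀‖ ^ 2 := by gcongr
        nlinarith
      have h2 : b y < 0 := mul_neg_of_pos_of_neg hε (sub_neg.2 h1)
      linarith [hle y (hρΩ (sphere_subset_closedBall hy))]
  · have hyΩ : y ∈ Ω := (hbP y hy).1
    have hF' := hMF y hy
    have hF1 := (norm_fst_le (F y)).trans hF'
    have hF2 := (norm_snd_le (F y)).trans hF'
    have hF3 := (norm_snd_le (F y).2).trans hF2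
    have hF4 := (norm_snd_le (F y).2.2).trans hF3
    have hbound := barrier_divergence_lower_bound (X := X) (x₀ := x₀) hα0.le hε.le hM0
      (convex_ball ξ₀ r) hAd
      (fun ξ hξ => (hMA ξ hξ).trans ((le_max_left _ _).trans (le_max_right _ _))) hLip
      ((le_max_right _ _).trans (le_max_right _ _)) hcoer
      ((hg₂C.contDiffAt (hΩ.mem_nhds hyΩ)).differentiableAt one_ne_zero)
      ((hqC.contDiffAt (hΩ.mem_nhds hyΩ)).differentiableAt one_ne_zero)
      hF1 ((norm_fst_le (F y).2).trans hF2) ((norm_fst_le (F y).2.2).trans hF3)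
      (fun i => (norm_le_pi_norm (fun j => X j y) i).trans ((norm_fst_le (F y).2.2.2).trans hF4))
      (fun i => (norm_le_pi_norm (fun j => divergence (X j) y) i).trans
        ((norm_snd_le (F y).2.2.2).trans hF4))
      (hqX y) (ball_subset_ball (half_le_self hr.le) (hbP y hy).2.2.1) (hgb y hy)
    rw [hbg]
    refine lt_of_lt_of_le ?_ hbound
    have hεE : 0 < ε * E y := mul_pos hε (hE0 y)
    have hqy : (‖q z‖ / 2) ^ 2 ≤ ‖q y‖ ^ 2 := by
      have := (hbP y hy).2.2.2.1.le
      gcongr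
    have h1 : L + 1 ≤ 4 * α ^ 2 * c * ‖q y‖ ^ 2 - 2 * α * Q := by
      have h2 : 4 * α ^ 2 * c * (‖q z‖ / 2) ^ 2 ≤ 4 * α ^ 2 * c * ‖q y‖ ^ 2 := by gcongr
      have h3 : α * (2 * Q + L + 1) ≤ α * (α * (4 * c * (‖q z‖ / 2) ^ 2)) := by gcongr
      nlinarith
    have h4 : L * b y ≤ L * (ε * E y) := by gcongr; exact hbE y
    have h5 : ε * E y * (L + 1) ≤ ε * E y * (4 * α ^ 2 * c * ‖q y‖ ^ 2 - 2 * α * Q) := by gcongr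
    refine lt_of_lt_of_le ?_ h5
    linarith

theorem theorem1p1 {n m : ℕ}
    (Ω : Set (EuclideanSpace ℝ (Fin n))) (hΩo : IsOpen Ω) (hΩc : IsConnected Ω)
    (X : Fin m → EuclideanSpace ℝ (Fin n) → EuclideanSpace ℝ (Fin n))
    (hX : ∀ j, ContDiffOn ℝ ∞ (X j) Ω) (hH : HormanderCondition X Ω)
    (A : EuclideanSpace ℝ (Fin m) → EuclideanSpace ℝ (Fin m))
    (hA : DifferentiableOn ℝ A {0}ᶜ) (hA' : LocallyLipschitzOn {0}ᶜ (fderiv ℝ A))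
    (p β γ κ : ℝ) (hp : 1 < p) (hβ : 0 < β) (hγ : 0 < γ) (hκ : 0 ≤ κ)
    (hS : StructureConditions A p β γ κ)
    (f : EuclideanSpace ℝ (Fin n) → ℝ → ℝ)
    (u₁ u₂ : EuclideanSpace ℝ (Fin n) → ℝ)
    (hu₁ : ContDiffOn ℝ 1 u₁ Ω) (hu₂ : ContDiffOn ℝ 2 u₂ Ω)
    (hw₁ : IsWeakSolution X A f Ω u₁) (hw₂ : IsWeakSolution X A f Ω u₂)
    (hf : ∀ x ∈ Ω, Antitone (f x))
    (L ε₀ : ℝ) (hL : 0 < L) (hε₀ : 0 < ε₀)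
    (hfL : ∀ x ∈ Ω, ∀ ε ∈ Icc 0 ε₀, |f x (u₂ x + ε) - f x (u₂ x)| ≤ L * ε)
    (δ : ℝ) (hδ : 0 < δ) (hXu₂ : ∀ x ∈ Ω, δ ≤ ‖horizontalGradient X u₂ x‖)
    (hle : ∀ x ∈ Ω, u₂ x ≤ u₁ x) :
    (∀ x ∈ Ω, u₁ x = u₂ x) ∨ (∀ x ∈ Ω, u₂ x < u₁ x) := by
  have hT : ∀ j, TangentTo (X j) {x ∈ Ω | u₁ x = u₂ x} :=
    IsWeakSolution.tangentTo_contactSet hΩo hX hA hA' hS hβ hκ hw₁ hw₂ hu₁ hu₂ hf hL hε₀ hfL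
      (fun x hx => norm_pos_iff.1 (hδ.trans_le (hXu₂ x hx))) hle
  have hopen : IsOpen (Ω \ {x ∈ Ω | u₁ x = u₂ x}) := by
    have h : Ω \ {x ∈ Ω | u₁ x = u₂ x} = Ω ∩ (fun x => u₁ x - u₂ x) ⁻¹' {0}ᶜ := by
      ext x
      simp [sub_eq_zero]
    rw [h]
    exact (hu₁.continuousOn.sub hu₂.continuousOn).isOpen_inter_preimage hΩo isOpen_compl_singleton
  rcases eq_empty_or_eq_of_tangentTo hΩo hΩc.isPreconnected (sep_subset _ _) hopen hX hH hT with h | h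
  · refine Or.inr fun x hx => lt_of_le_of_ne (hle x hx) fun he => ?_
    exact (h ▸ (⟨hx, he.symm⟩ : x ∈ {x ∈ Ω | u₁ x = u₂ x}) : x ∈ (∅ : Set _))
  · exact Or.inl fun x hx => (h.symm ▸ hx : x ∈ {x ∈ Ω | u₁ x = u₂ x}).2
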